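/- **Setting.** Let $E$ be a non-empty standard Borel space (for instance $E=\mathbb R$) and let $f_0,f_1,f_2,\dots$ be an $E$-valued Markov chain, possibly inhomogeneous in time, realized as the coordinates on the trajectory space $X=E^{\mathbb N}$ with law $\mu$. Let $\mathfrak A_n$ be the $\sigma$-algebra generated by the $f_k$, $k\ge n$. Assume that the chain has finite sets of transitions: for every $n$ and almost every value of $f_{n+1}$, the conditional distribution of $f_n$ given $f_{n+1}$ has finite support. *Admissible metrics.* An admissible metric on $(X,\mu)$ is a measurable metric $\rho$ on $X$ that is separable on a set of full measure and satisfies $\int_X\int_X\rho\,d\mu\,d\mu<\infty$. For a semimetric $c$ and probability measures $\alpha,\beta$ let $K_c(\alpha,\beta)=\inf_\psi\int c\,d\psi$ be the Kantorovich distance, where $\psi$ runs over all couplings of $\alpha$ and $\beta$. *Standard chains.* Given an admissible metric $\rho$, put $\rho_0=\rho$ and $\rho_{n+1}(x,y)=K_{\rho_n}(\mu^x,\mu^y)$, where $\mu^x$ is the conditional measure of $\mu$ given $\mathfrak A_{n+1}$ at the point $x$. The chain is called *standard* if it is ergodic, i.e. $\bigcap_n\mathfrak A_n$ is trivial mod $\mu$,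 and if for some admissible metric $\rho$ $$\lim_{n\to\infty}\int_X\int_X\rho_n(x,y)\,d\mu(x)\,d\mu(y)=0 .$$ *Markov couplings.* For $s\in E$ let $\mu_n^s$ be the conditional distribution of $(f_0,\dots,f_{n-1})$ on $E^n$ given $f_n=s$. For $0\le k\le n$ and $a\in E^n$ let $S_k(a)=\{u\in E^n: u_i=a_i \text{ for } k\le i<n\}$; these sets are the vertices of the tree of trajectories that starts at the value of $f_n$. A coupling $\psi$ of $\alpha=\mu_n^s$ and $\beta=\mu_n^t$ is a *Markov coupling* if for all $k,a,b$ with $\psi(S_k(a)\times S_k(b))>0$ the conditional measure $\psi(\,\cdot\mid S_k(a)\times S_k(b))$ is a coupling of $\alpha(\,\cdot\mid S_k(a))$ and $\beta(\,\cdot\mid S_k(b))$. **Theorem.** Let $\rho$ be any admissible metric on $(X,\mu)$, and let $d_n$ be measurable semimetrics on $E^n$, $n\ge 0$, that approximate $\rho$: $$\int_X\int_X\bigl|d_n\bigl((x_0,\dots,x_{n-1}),(y_0,\dots,y_{n-1})\bigr)-\rho(x,y)\bigr|\,d\mu(x)\,d\mu(y)\to0 .$$ Put $$r_n(s,t)=\inf_\psi\int_{E^n\times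 E^n} d_n(u,v)\,d\psi(u,v),\qquad s,t\in E,$$ where $\psi$ runs over all Markov couplings of $\mu_n^s$ and $\mu_n^t$. Then the chain is standard if and only if $$\lim_{n\to\infty}\int_X\int_X r_n(x_n,y_n)\,d\mu(x)\,d\mu(y)=0 .$$ -/

import Mathlib

open Filter Topology MeasureTheory ProbabilityTheory
open scoped ENNReal

noncomputable section

namespace VershikStandard

/-! ### Semimetrics and the Kantorovich distance -/

/-- `ρ` is a semimetric on `Z`: distinct points may be at distance zero. -/
structure IsSemimetric {Z : Type*} (ρ : Z → Z → ℝ) : Prop where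
  self_eq_zero : ∀ x, ρ x x = 0
  symm : ∀ x y, ρ x y = ρ y x
  triangle : ∀ x y z, ρ x z ≤ ρ x y + ρ y z

/-- `ρ` is an (integrable) admissible metric on the measure space `(Z, μ)`: a measurable metric,
separable on a set of full measure, with `∫∫ ρ dμ dμ < ∞`. -/
structure IsAdmissibleMetric {Z : Type*} [MeasurableSpace Z] (μ : Measure Z)
    (ρ : Z → Z → ℝ) : Prop extends IsSemimetric ρ where
  eq_of_eq_zero : ∀ x y, ρ x y = 0 → x = y
  measurable : Measurable (Function.uncurry ρ)
  separable : ∃ S : Set Z, S.Countable ∧ ∀ᵐ x ∂μ, ∀ ε > 0, ∃ s ∈ S, ρ x s < ε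
  integrable : ∫⁻ x, ∫⁻ y, ENNReal.ofReal (ρ x y) ∂μ ∂μ < ∞

/-- `ψ` is a coupling of `α` and `β`: its coordinate projections are `α` and `β`. -/
def IsCoupling {Z : Type*} [MeasurableSpace Z] (α β : Measure Z) (ψ : Measure (Z × Z)) : Prop :=
  ψ.map Prod.fst = α ∧ ψ.map Prod.snd = β

/-- The Kantorovich distance `K_c(α, β) = inf_ψ ∫∫ c(a, b) dψ(a, b)` over all couplings. -/
def kantorovich {Z : Type*} [MeasurableSpace Z] (c : Z → Z → ℝ≥0∞) (α β : Measure Z) : ℝ≥0∞ :=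
  ⨅ (ψ : Measure (Z × Z)) (_ : IsCoupling α β ψ), ∫⁻ p, c p.1 p.2 ∂ψ

/-- Transferring the semimetric `c` along the measurable partition that corresponds to the
σ-algebra `m`: the new distance of `x` and `y` is the Kantorovich distance of the conditional
measures on the elements of the partition that contain `x` and `y`. -/
def transfer {X : Type*} (m : MeasurableSpace X) [MeasurableSpace X] [StandardBorelSpace X]
    (μ : Measure X) [IsFiniteMeasure μ] (c : X → X → ℝ≥0∞) (x y : X) : ℝ≥0∞ :=
  kantorovich c (condExpKernel μ m x) (condExpKernel μ m y)

/-! ### Markov chains and their filtrations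

A chain `f₀, f₁, f₂, …` with values in `E` is given by its law `μ` on the space `ℕ → E` of
trajectories; `fₙ` is the `n`-th coordinate. -/

variable {E : Type*} [MeasurableSpace E]

/-- The vector of the first `n` variables `(f₀, …, f_{n-1})`. -/
def initialSegment (E : Type*) (n : ℕ) (x : ℕ → E) : Fin n → E := fun i => x i

/-- The σ-algebra generated by `f₀, …, f_{n-1}`. -/
abbrev pastAlgebra (E : Type*) [MeasurableSpace E] (n : ℕ) : MeasurableSpace (ℕ → E) :=
  MeasurableSpace.comap (initialSegment E n) inferInstance

/-- The σ-algebra `𝔄ₙ` generated by the variables `f_k`, `k ≥ n`. -/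
abbrev tailAlgebra (E : Type*) [MeasurableSpace E] (n : ℕ) : MeasurableSpace (ℕ → E) :=
  MeasurableSpace.comap (fun x (k : ℕ) => x (n + k)) inferInstance

/-- The σ-algebra generated by `fₙ`. -/
abbrev presentAlgebra (E : Type*) [MeasurableSpace E] (n : ℕ) : MeasurableSpace (ℕ → E) :=
  MeasurableSpace.comap (fun x => x n) inferInstance

theorem presentAlgebra_le (n : ℕ) :
    presentAlgebra E n ≤ (inferInstance : MeasurableSpace (ℕ → E)) :=
  (measurable_pi_apply n).comap_le

/-- The Markov property, for a chain that may be inhomogeneous in time: for every `n`, given `fₙ`,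
the variables with indices `≤ n` are independent of the variables with indices `≥ n`. -/
def IsMarkovChain [StandardBorelSpace E] (μ : Measure (ℕ → E)) [IsFiniteMeasure μ] : Prop :=
  ∀ n, CondIndep (presentAlgebra E n) (pastAlgebra E (n + 1)) (tailAlgebra E n)
    (presentAlgebra_le n) μ

/-- The chain has finite sets of transitions: for every `n`, given almost every value of `f_{n+1}`,
the variable `fₙ` takes only finitely many values. -/
def HasFiniteTransitions [StandardBorelSpace E] [Nonempty E] (μ : Measure (ℕ → E))
    [IsFiniteMeasure μ] : Prop :=
  ∀ n, ∀ᵐ x ∂μ, ∃ S : Finset E,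
    condDistrib (fun z : ℕ → E => z n) (fun z => z (n + 1)) μ (x (n + 1)) (S : Set E)ᶜ = 0

/-- The zero–one law: the intersection of the σ-algebras `𝔄ₙ` is trivial. -/
def IsErgodicChain (μ : Measure (ℕ → E)) : Prop :=
  ∀ A : Set (ℕ → E), MeasurableSet[⨅ n, tailAlgebra E n] A → μ A = 0 ∨ μ A = 1

/-! ### Standardness -/

/-- The iterated semimetrics: `ρ₀ = ρ`, and `ρ_{n+1}` is `ρₙ` transferred along `𝔄_{n+1}`. -/
def iteratedSemimetric [StandardBorelSpace E] (μ : Measure (ℕ → E)) [IsFiniteMeasure μ]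
    (ρ : (ℕ → E) → (ℕ → E) → ℝ) : ℕ → (ℕ → E) → (ℕ → E) → ℝ≥0∞
  | 0 => fun x y => ENNReal.ofReal (ρ x y)
  | n + 1 => transfer (tailAlgebra E (n + 1)) μ (iteratedSemimetric μ ρ n)

/-- A chain is standard if it is ergodic and, for some initial metric `ρ`, the iterated semimetrics
satisfy `∫∫ ρₙ dμ dμ → 0`. -/
def IsStandardChain [StandardBorelSpace E] (μ : Measure (ℕ → E)) [IsFiniteMeasure μ] : Prop :=
  IsErgodicChain μ ∧ ∃ ρ : (ℕ → E) → (ℕ → E) → ℝ, IsAdmissibleMetric μ ρ ∧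
    Tendsto (fun n => ∫⁻ x, ∫⁻ y, iteratedSemimetric μ ρ n x y ∂μ ∂μ) atTop (𝓝 0)

/-! ### Markov couplings and the functions `rₙ` -/

/-- The vectors in `Eⁿ` with the same coordinates as `a` from index `k` on. The vectors are the
branches of a tree whose root is the value of the next variable; the sets `branchesThrough k a`
are its vertices at distance `n - k` from the root (`k = n` is the root itself). -/
def branchesThrough {n : ℕ} (k : ℕ) (a : Fin n → E) : Set (Fin n → E) :=
  {u | ∀ i : Fin n, k ≤ (i : ℕ) → u i = a i}

/-- `ψ` is a Markov coupling of two measures on `Eⁿ` (with discrete support): besides being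
a coupling it respects the tree structures, i.e. for every pair of vertices of the same level, of
positive `ψ`-measure, the conditional measure of `ψ` on the pairs of branches through these two
vertices is a coupling of the conditional measures of `α` and `β` on the two subtrees. -/
def IsMarkovCoupling {n : ℕ} (α β : Measure (Fin n → E))
    (ψ : Measure ((Fin n → E) × (Fin n → E))) : Prop :=
  IsCoupling α β ψ ∧ ∀ (k : ℕ) (a b : Fin n → E),
    ψ (branchesThrough k a ×ˢ branchesThrough k b) ≠ 0 →
      IsCoupling (ProbabilityTheory.cond α (branchesThrough k a)) (ProbabilityTheory.cond β (branchesThrough k b))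
        (ProbabilityTheory.cond ψ (branchesThrough k a ×ˢ branchesThrough k b))

/-- The conditional distribution of `(f₀, …, f_{n-1})` given `fₙ = s`. -/
def condInitial [StandardBorelSpace E] [Nonempty E] (μ : Measure (ℕ → E)) [IsFiniteMeasure μ]
    (n : ℕ) (s : E) : Measure (Fin n → E) :=
  condDistrib (initialSegment E n) (fun x => x n) μ s

/-- `rₙ(s, t)`: the least mean distance `d` under a Markov coupling of the conditional distributions
of the first `n` variables given `fₙ = s` and given `fₙ = t`. -/
def markovDistance [StandardBorelSpace E] [Nonempty E] (μ : Measure (ℕ → E)) [IsFiniteMeasure μ]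
    (n : ℕ) (d : (Fin n → E) → (Fin n → E) → ℝ) (s t : E) : ℝ≥0∞ :=
  ⨅ (ψ : Measure ((Fin n → E) × (Fin n → E)))
    (_ : IsMarkovCoupling (condInitial μ n s) (condInitial μ n t) ψ),
    ∫⁻ p, ENNReal.ofReal (d p.1 p.2) ∂ψ

/-- Measurable semimetrics `dₙ` on the spaces `Eⁿ` of initial segments that approximate `ρ`:
`∫∫ |dₙ(x|ₙ, y|ₙ) - ρ(x, y)| dμ dμ → 0`. -/
structure IsCylinderApproximation (μ : Measure (ℕ → E)) (ρ : (ℕ → E) → (ℕ → E) → ℝ)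
    (d : (n : ℕ) → (Fin n → E) → (Fin n → E) → ℝ) : Prop where
  isSemimetric : ∀ n, IsSemimetric (d n)
  measurable : ∀ n, Measurable (Function.uncurry (d n))
  tendsto : Tendsto (fun n => ∫⁻ x, ∫⁻ y,
    ENNReal.ofReal |d n (initialSegment E n x) (initialSegment E n y) - ρ x y| ∂μ ∂μ) atTop (𝓝 0)

end VershikStandard

end

noncomputable section

namespace VershikStandard

/-! ### Comparison of semimetrics up to functions with small integral -/

section Semimetric

variable {X : Type*} {ρ : X → X → ℝ}

/-! Everything rests on the stability of the Kantorovich transfer under errors of the form `φ x + φ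
y`. The integral of such a function against a coupling depends only on the marginals, so `c ≤ C c' +
φ ⊕ φ` passes to the transferred costs, with `φ` replaced by its conditional mean, whose integral is
the same. After any number of transfers the double integrals therefore satisfy the same inequality
with error `2 ∫ φ`, uniformly in the number of steps (`lintegral_iteratedCost_le`).

This reduces the theorem to comparisons of initial costs. Any admissible metric is bounded by a
multiple of any other one up to such an error with `∫ φ` arbitrarily small
(`IsAdmissibleMetric.isDominated`), so convergence to zero does not depend on the metric. The
semimetrics `dₙ` and `ρ` bound each other up to such an error for large `n`
(`IsAdmissibleMetric.eventually_comparison`): mean convergence of semimetrics is upgraded by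
averaging over the cells of a finite quantization.

It remains to see that transferring the cylinder cost `dₙ` exactly `n` times gives `rₙ`. By the
Markov property and finite transitions, the conditional measures met on the way are the normalized
restrictions of the law of the initial segment to the vertices of a finite tree
(`IsMarkovChain.ae_condExpKernel_glue`). On such a tree the cheapest Markov coupling is found by
dynamic programming, and its cost is the iterated Kantorovich distance (`iInf_isMarkovCoupling_eq`).

Ergodicity comes for free. The cost separating a tail set from its complement does not decrease
under transfer, while its domination by `ρ` forces its iterates to zero in the mean; hence the set
is trivial (`isErgodicChain_of_tendsto`). -/

theorem IsSemimetric.nonneg (h : IsSemimetric ρ) (x y : X) : 0 ≤ ρ x y := by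
  have h1 := h.triangle x y x
  rw [h.self_eq_zero, h.symm y x] at h1
  linarith

theorem IsSemimetric.ofReal_triangle (h : IsSemimetric ρ) (x y z : X) :
    ENNReal.ofReal (ρ x z) ≤ ENNReal.ofReal (ρ x y) + ENNReal.ofReal (ρ y z) := by
  rw [← ENNReal.ofReal_add (h.nonneg _ _) (h.nonneg _ _)]
  exact ENNReal.ofReal_le_ofReal (h.triangle x y z)

theorem ofReal_le_ofReal_add_abs (a b : ℝ) :
    ENNReal.ofReal a ≤ ENNReal.ofReal b + ENNReal.ofReal |a - b| := by
  refine le_trans (ENNReal.ofReal_le_ofReal ?_) ENNReal.ofReal_add_le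
  linarith [le_abs_self (a - b)]

end Semimetric

/-! ### Finite quantization of an admissible metric. -/

section Approximation

variable {X : Type*} [MeasurableSpace X]

theorem IsAdmissibleMetric.measurable_ofReal {μ : Measure X} {ρ : X → X → ℝ}
    (hρ : IsAdmissibleMetric μ ρ) :
    Measurable (Function.uncurry fun x y => ENNReal.ofReal (ρ x y)) :=
  hρ.measurable.ennreal_ofReal

/-- Integrability of the double integral gives some `z` with finite mean distance to the space; the
triangle inequality through `z` carries this to every `s`. -/
theorem IsAdmissibleMetric.lintegral_lt_top {μ : Measure X} [IsProbabilityMeasure μ]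
    {ρ : X → X → ℝ} (hρ : IsAdmissibleMetric μ ρ) (s : X) :
    ∫⁻ x, ENNReal.ofReal (ρ x s) ∂μ < ∞ := by
  have hmeas : Measurable fun x => ∫⁻ y, ENNReal.ofReal (ρ x y) ∂μ :=
    hρ.measurable_ofReal.lintegral_prod_right'
  obtain ⟨z, hz⟩ := (ae_lt_top hmeas hρ.integrable.ne).exists
  calc ∫⁻ x, ENNReal.ofReal (ρ x s) ∂μ
      ≤ ∫⁻ x, (ENNReal.ofReal (ρ z x) + ENNReal.ofReal (ρ z s)) ∂μ := by
        refine lintegral_mono fun x => ?_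
        have := hρ.ofReal_triangle x z s
        rwa [hρ.symm x z] at this
    _ = ∫⁻ x, ENNReal.ofReal (ρ z x) ∂μ + ENNReal.ofReal (ρ z s) := by
        rw [lintegral_add_right _ measurable_const]; simp
    _ < ∞ := by finiteness

/-- A sequence that approximates almost every point. -/
theorem IsAdmissibleMetric.exists_dense_seq {μ : Measure X} [IsProbabilityMeasure μ]
    {ρ : X → X → ℝ} (hρ : IsAdmissibleMetric μ ρ) :
    ∃ s : ℕ → X, ∀ᵐ x ∂μ, ∀ ε > 0, ∃ n, ρ x (s n) < ε := by
  obtain ⟨S, hS, h⟩ := hρ.separable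
  obtain ⟨x, hx⟩ := h.exists
  obtain ⟨t, ht, -⟩ := hx 1 one_pos
  obtain ⟨s, rfl⟩ := hS.exists_eq_range ⟨t, ht⟩
  refine ⟨s, ?_⟩
  filter_upwards [h] with x hx ε hε
  obtain ⟨_, ⟨n, rfl⟩, hn⟩ := hx ε hε
  exact ⟨n, hn⟩

/-- The index of a point of `s 0, …, s m` that is nearest to `x`. -/
def nearestIndex (ρ : X → X → ℝ) (s : ℕ → X) : ℕ → X → ℕ
  | 0, _ => 0
  | m + 1, x => open Classical in
      if ρ x (s (m + 1)) < ρ x (s (nearestIndex ρ s m x)) then m + 1 else nearestIndex ρ s m x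

omit [MeasurableSpace X] in
theorem nearestIndex_le (ρ : X → X → ℝ) (s : ℕ → X) (m : ℕ) (x : X) :
    nearestIndex ρ s m x ≤ m := by
  induction m with
  | zero => rfl
  | succ m ih => unfold nearestIndex; split_ifs <;> omega

omit [MeasurableSpace X] in
theorem nearestIndex_min (ρ : X → X → ℝ) (s : ℕ → X) (x : X) {m n : ℕ} (h : n ≤ m) :
    ρ x (s (nearestIndex ρ s m x)) ≤ ρ x (s n) := by
  induction m with
  | zero => obtain rfl : n = 0 := by omega
            rfl
  | succ m ih =>
    unfold nearestIndex
    rcases Nat.lt_or_ge m n with hn | hn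
    · obtain rfl : n = m + 1 := by omega
      split_ifs with h1
      · exact le_rfl
      · exact not_lt.1 h1
    · split_ifs with h1
      · exact h1.le.trans (ih hn)
      · exact ih hn

theorem measurable_nearestIndex {ρ : X → X → ℝ} (hρ : Measurable (Function.uncurry ρ))
    (s : ℕ → X) (m : ℕ) : Measurable (nearestIndex ρ s m) := by
  induction m with
  | zero => exact measurable_const
  | succ m ih =>
    have h1 : Measurable fun x => ρ x (s (m + 1)) := hρ.comp (measurable_id.prodMk measurable_const)
    have h2 : Measurable fun x => ρ x (s (nearestIndex ρ s m x)) :=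
      hρ.comp (measurable_id.prodMk (measurable_from_nat.comp ih))
    exact Measurable.ite (measurableSet_lt h1 h2) measurable_const ih

/-- Approximation of almost every point by finitely many points, with a small mean error. -/
theorem IsAdmissibleMetric.exists_quantization {μ : Measure X} [IsProbabilityMeasure μ]
    {ρ : X → X → ℝ} (hρ : IsAdmissibleMetric μ ρ) {ε : ℝ≥0∞} (hε : ε ≠ 0) :
    ∃ (m : ℕ) (s : ℕ → X) (κ : X → ℕ), Measurable κ ∧ (∀ x, κ x < m) ∧
      ∫⁻ x, ENNReal.ofReal (ρ x (s (κ x))) ∂μ ≤ ε := by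
  obtain ⟨s, hs⟩ := hρ.exists_dense_seq
  -- Distances to the nearest of `s 0, …, s m` tend to zero almost everywhere and are dominated by
  -- the integrable distance to `s 0`.
  have hlim : Tendsto (fun m => ∫⁻ x, ENNReal.ofReal (ρ x (s (nearestIndex ρ s m x))) ∂μ) atTop
      (𝓝 (∫⁻ _, 0 ∂μ)) := by
    refine tendsto_lintegral_of_dominated_convergence (fun x => ENNReal.ofReal (ρ x (s 0)))
      (fun m => ?_) (fun m => ?_) (hρ.lintegral_lt_top (s 0)).ne ?_
    · exact (hρ.measurable.comp (measurable_id.prodMk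
        (measurable_from_nat.comp (measurable_nearestIndex hρ.measurable s m)))).ennreal_ofReal
    · exact ae_of_all _ fun x => ENNReal.ofReal_le_ofReal (nearestIndex_min ρ s x (Nat.zero_le m))
    · filter_upwards [hs] with x hx
      rw [← ENNReal.ofReal_zero]
      refine (ENNReal.continuous_ofReal.tendsto 0).comp ?_
      rw [Metric.tendsto_atTop]
      intro δ hδ
      obtain ⟨n, hn⟩ := hx δ hδ
      refine ⟨n, fun m hm => ?_⟩
      rw [Real.dist_eq, sub_zero, abs_of_nonneg (hρ.nonneg _ _)]
      exact (nearestIndex_min ρ s x hm).trans_lt hn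
  rw [lintegral_zero] at hlim
  obtain ⟨m, hm⟩ := (hlim.eventually (ge_mem_nhds hε.bot_lt)).exists
  exact ⟨m + 1, s, nearestIndex ρ s m, measurable_nearestIndex hρ.measurable s m,
    fun x => Nat.lt_succ_of_le (nearestIndex_le ρ s m x), hm⟩

end Approximation

/-! ### Averaging over the cells of a finite partition. -/

section CellAverages

variable {X : Type*} [MeasurableSpace X] (μ : Measure X) (κ : X → ℕ)

/-- The normalized restriction of `μ` to the cell `{κ = i}` (zero for null cells). -/
def cellMeasure (i : ℕ) : Measure X := ProbabilityTheory.cond μ (κ ⁻¹' {i})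

/-- The density of `cellMeasure μ κ i` on its cell. -/
def cellWeight (i : ℕ) : ℝ≥0∞ := open Classical in if μ (κ ⁻¹' {i}) = 0 then 0 else (μ (κ ⁻¹' {i}))⁻¹

/-- This is the reason for the value zero on null cells, where the plain inverse would be infinite:
sums of weights have to be finite constants. -/
theorem cellWeight_ne_top (i : ℕ) : cellWeight μ κ i ≠ ∞ := by
  unfold cellWeight
  split_ifs with h
  · exact ENNReal.zero_ne_top
  · exact ENNReal.inv_ne_top.2 h

theorem cellMeasure_eq (i : ℕ) :
    cellMeasure μ κ i = cellWeight μ κ i • μ.restrict (κ ⁻¹' {i}) := by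
  unfold cellMeasure cellWeight ProbabilityTheory.cond
  split_ifs with h
  · rw [Measure.restrict_eq_zero.2 h]; simp
  · rfl

theorem cellMeasure_le (i : ℕ) : cellMeasure μ κ i ≤ cellWeight μ κ i • μ := by
  rw [cellMeasure_eq]
  gcongr
  exact Measure.restrict_le_self

theorem cellWeight_mul_le (i : ℕ) : μ (κ ⁻¹' {i}) * cellWeight μ κ i ≤ 1 := by
  unfold cellWeight
  split_ifs with h
  · simp
  · exact ENNReal.mul_inv_le_one _

theorem lintegral_cellMeasure_le (i : ℕ) (f : X → ℝ≥0∞) :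
    ∫⁻ z, f z ∂cellMeasure μ κ i ≤ cellWeight μ κ i * ∫⁻ z, f z ∂μ := by
  calc _ ≤ ∫⁻ z, f z ∂(cellWeight μ κ i • μ) := lintegral_mono' (cellMeasure_le μ κ i) le_rfl
    _ = _ := by rw [lintegral_smul_measure, smul_eq_mul]

variable {κ}

instance [IsProbabilityMeasure μ] (i : ℕ) : IsZeroOrProbabilityMeasure (cellMeasure μ κ i) := by
  unfold cellMeasure
  infer_instance

theorem measurable_lintegral_cellMeasure [IsProbabilityMeasure μ] (hκ : Measurable κ)
    {A : X → X → ℝ≥0∞}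
    (hA : Measurable (Function.uncurry A)) :
    Measurable fun x => ∫⁻ z, A x z ∂cellMeasure μ κ (κ x) := by
  have h : ∀ i, Measurable fun x => ∫⁻ z, A x z ∂cellMeasure μ κ i := fun i =>
    Measurable.lintegral_prod_right' (ν := cellMeasure μ κ i) hA
  intro t ht
  have : (fun x => ∫⁻ z, A x z ∂cellMeasure μ κ (κ x)) ⁻¹' t =
      ⋃ i, κ ⁻¹' {i} ∩ (fun x => ∫⁻ z, A x z ∂cellMeasure μ κ i) ⁻¹' t := by
    ext x
    simp
  rw [this]
  exact MeasurableSet.iUnion fun i => (hκ (measurableSet_singleton i)).inter (h i ht)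

theorem lintegral_fiber (hκ : Measurable κ) (f : X → ℝ≥0∞) :
    ∫⁻ x, f x ∂μ = ∑' i, ∫⁻ x in κ ⁻¹' {i}, f x ∂μ := by
  rw [← lintegral_iUnion (fun i => hκ (measurableSet_singleton i))]
  · rw [← Set.preimage_iUnion, Set.iUnion_of_singleton, Set.preimage_univ, Measure.restrict_univ]
  · intro i j hij
    exact Disjoint.preimage _ (by simpa using hij)

/-- Averaging over cells preserves the mean: on each cell the mass cancels the normalization. One
inequality is enough and needs no separate treatment of null cells. -/
theorem lintegral_lintegral_cellMeasure_le (hκ : Measurable κ) (g : ℕ → X → ℝ≥0∞) :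
    ∫⁻ x, ∫⁻ z, g (κ x) z ∂cellMeasure μ κ (κ x) ∂μ ≤ ∫⁻ z, g (κ z) z ∂μ := by
  rw [lintegral_fiber μ hκ, lintegral_fiber μ hκ (fun z => g (κ z) z)]
  refine ENNReal.tsum_le_tsum fun i => ?_
  have hm : MeasurableSet (κ ⁻¹' {i}) := hκ (measurableSet_singleton i)
  rw [setLIntegral_congr_fun hm (f := fun x => ∫⁻ z, g (κ x) z ∂cellMeasure μ κ (κ x))
      (g := fun _ => ∫⁻ z, g i z ∂cellMeasure μ κ i),
    setLIntegral_congr_fun hm (f := fun x => g (κ x) x) (g := g i)]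
  · rw [lintegral_const, Measure.restrict_apply_univ, cellMeasure_eq, lintegral_smul_measure,
      smul_eq_mul, mul_comm, ← mul_assoc]
    calc _ ≤ 1 * ∫⁻ z in κ ⁻¹' {i}, g i z ∂μ := by
          gcongr; exact cellWeight_mul_le μ κ i
      _ = _ := one_mul _
  · intro x hx
    simp only [Set.mem_preimage, Set.mem_singleton_iff] at hx
    simp only [hx]
  · intro x hx
    simp only [Set.mem_preimage, Set.mem_singleton_iff] at hx
    simp only [hx]

variable (κ) in
/-- The mean distances from `x` to the points of its cell, plus the mean of `D` on pairs of
cells; infinite on null cells. -/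
def cellError (m : ℕ) (A B D : X → X → ℝ≥0∞) (x : X) : ℝ≥0∞ := open Classical in
  if μ (κ ⁻¹' {κ x}) = 0 then ∞ else
    ∫⁻ z, (A x z + B x z) ∂cellMeasure μ κ (κ x) +
      ∑ i ∈ Finset.range m, ∑ j ∈ Finset.range m,
        ∫⁻ z, ∫⁻ w, D z w ∂cellMeasure μ κ j ∂cellMeasure μ κ i

variable [IsProbabilityMeasure μ]

theorem measurable_cellError (hκ : Measurable κ) (m : ℕ) {A B : X → X → ℝ≥0∞}
    (hA : Measurable (Function.uncurry A)) (hB : Measurable (Function.uncurry B))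
    (D : X → X → ℝ≥0∞) : Measurable (cellError μ κ m A B D) := by
  refine Measurable.ite ?_ measurable_const
    ((measurable_lintegral_cellMeasure μ hκ (A := fun x z => A x z + B x z)
      (hA.add hB)).add measurable_const)
  exact hκ (MeasurableSet.of_discrete (s := {i | μ (κ ⁻¹' {i}) = 0}))

-- The symmetry lets a single error function serve both directions of the comparison.
omit [IsProbabilityMeasure μ] in
theorem cellError_comm (m : ℕ) (A B D : X → X → ℝ≥0∞) :
    cellError μ κ m A B D = cellError μ κ m B A D := by
  ext x
  simp only [cellError, add_comm]

/-- Move `x` to `z` in its cell and `y` to `w` in its cell, exchange `A` for `B` at the cost `D z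
w`, and move back; then average over `z` and `w`. After averaging, `D` enters only through means
over pairs of cells. The infinite value on null cells makes the bound valid at every pair of points.
-/
theorem le_add_cellError {m : ℕ} (hm : ∀ x, κ x < m) {A B D : X → X → ℝ≥0∞}
    (hA : Measurable (Function.uncurry A)) (hB : Measurable (Function.uncurry B))
    (sA : ∀ x y, A x y = A y x) (tA : ∀ x y z, A x z ≤ A x y + A y z)
    (sB : ∀ x y, B x y = B y x) (tB : ∀ x y z, B x z ≤ B x y + B y z)
    (hAB : ∀ x y, A x y ≤ B x y + D x y) (x y : X) :
    A x y ≤ B x y + (cellError μ κ m A B D x + cellError μ κ m A B D y) := by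
  unfold cellError
  split_ifs with hx hy hy
  · simp
  · simp
  · simp
  have : IsProbabilityMeasure (cellMeasure μ κ (κ x)) := cond_isProbabilityMeasure hx
  have : IsProbabilityMeasure (cellMeasure μ κ (κ y)) := cond_isProbabilityMeasure hy
  set M := ∑ i ∈ Finset.range m, ∑ j ∈ Finset.range m,
        ∫⁻ z, ∫⁻ w, D z w ∂cellMeasure μ κ j ∂cellMeasure μ κ i with hM
  have hDM : ∫⁻ z, ∫⁻ w, D z w ∂cellMeasure μ κ (κ y) ∂cellMeasure μ κ (κ x) ≤ M := by
    refine le_trans ?_ (Finset.single_le_sum (fun _ _ => zero_le) (Finset.mem_range.2 (hm x)))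
    exact Finset.single_le_sum (f := fun j =>
      ∫⁻ z, ∫⁻ w, D z w ∂cellMeasure μ κ j ∂cellMeasure μ κ (κ x)) (fun _ _ => zero_le)
      (Finset.mem_range.2 (hm y))
  have key : ∀ z w, A x y ≤ B x y + (A x z + B x z) + (D z w + (A y w + B y w)) := by
    intro z w
    calc A x y ≤ A x z + (A z w + A w y) := (tA x z y).trans (by gcongr; exact tA z w y)
      _ ≤ A x z + ((B z x + (B x y + B y w)) + D z w + A w y) := by
          gcongr
          refine (hAB z w).trans ?_
          gcongr
          exact (tB z x w).trans (by gcongr; exact tB x y w)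
      _ = _ := by rw [sA w y, sB z x]; ring
  have hAx : Measurable fun z => A x z + B x z :=
    (hA.comp measurable_prodMk_left).add (hB.comp measurable_prodMk_left)
  have hAy : Measurable fun z => A y z + B y z :=
    (hA.comp measurable_prodMk_left).add (hB.comp measurable_prodMk_left)
  calc A x y = ∫⁻ _, ∫⁻ _, A x y ∂cellMeasure μ κ (κ y) ∂cellMeasure μ κ (κ x) := by simp
    _ ≤ ∫⁻ z, ∫⁻ w, (B x y + (A x z + B x z) + (D z w + (A y w + B y w)))
          ∂cellMeasure μ κ (κ y) ∂cellMeasure μ κ (κ x) :=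
        lintegral_mono fun z => lintegral_mono fun w => key z w
    _ = ∫⁻ z, (B x y + (A x z + B x z) + (∫⁻ w, D z w ∂cellMeasure μ κ (κ y) +
          ∫⁻ w, (A y w + B y w) ∂cellMeasure μ κ (κ y))) ∂cellMeasure μ κ (κ x) := by
        refine lintegral_congr fun z => ?_
        rw [lintegral_add_left measurable_const, lintegral_add_right _ hAy]
        simp
    _ = B x y + ∫⁻ z, (A x z + B x z) ∂cellMeasure μ κ (κ x) +
          (∫⁻ z, ∫⁻ w, D z w ∂cellMeasure μ κ (κ y) ∂cellMeasure μ κ (κ x) +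
          ∫⁻ w, (A y w + B y w) ∂cellMeasure μ κ (κ y)) := by
        rw [lintegral_add_left (hAx.const_add _), lintegral_add_left measurable_const,
          lintegral_add_right _ measurable_const]
        simp
    _ ≤ B x y + ∫⁻ z, (A x z + B x z) ∂cellMeasure μ κ (κ x) +
          (M + ∫⁻ w, (A y w + B y w) ∂cellMeasure μ κ (κ y)) := by gcongr
    -- A second copy of `M` is added because it occurs in the error at `x` and again in the error at
    -- `y`.
    _ ≤ B x y + ∫⁻ z, (A x z + B x z) ∂cellMeasure μ κ (κ x) +
          (M + ∫⁻ w, (A y w + B y w) ∂cellMeasure μ κ (κ y)) + M := le_self_add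
    _ = _ := by ring

/-- Since `A + B ≤ 2B + D`, going through the centre `s (κ x)` costs twice the quantization error at
`x` and twice its cell average, whence the factor 4. The rest is a constant, depending only on the
partition, times the mean of `D`. -/
theorem lintegral_cellError_le (hκ : Measurable κ) {m : ℕ} (hm : ∀ x, κ x < m)
    {A B D : X → X → ℝ≥0∞} (hB : Measurable (Function.uncurry B))
    (hD : Measurable (Function.uncurry D))
    (sB : ∀ x y, B x y = B y x) (tB : ∀ x y z, B x z ≤ B x y + B y z)
    (hAB : ∀ x y, A x y ≤ B x y + D x y) (s : ℕ → X) :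
    ∫⁻ x, cellError μ κ m A B D x ∂μ ≤ 4 * ∫⁻ x, B x (s (κ x)) ∂μ +
      (∑ i ∈ Finset.range m, cellWeight μ κ i + ∑ i ∈ Finset.range m, ∑ j ∈ Finset.range m,
        cellWeight μ κ i * cellWeight μ κ j) * ∫⁻ x, ∫⁻ y, D x y ∂μ ∂μ := by
  have hnull : ∀ᵐ x ∂μ, μ (κ ⁻¹' {κ x}) ≠ 0 := by
    have : {x | ¬ μ (κ ⁻¹' {κ x}) ≠ 0} ⊆ ⋃ i ∈ {i | μ (κ ⁻¹' {i}) = 0}, κ ⁻¹' {i} := by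
      intro x hx
      simp only [ne_eq, not_not, Set.mem_ofPred_eq] at hx
      exact Set.mem_biUnion (x := κ x) hx rfl
    exact measure_mono_null this ((measure_biUnion_null_iff (Set.to_countable _)).2 fun i hi => hi)
  set M := ∑ i ∈ Finset.range m, ∑ j ∈ Finset.range m,
        ∫⁻ z, ∫⁻ w, D z w ∂cellMeasure μ κ j ∂cellMeasure μ κ i with hM
  set I := ∫⁻ x, ∫⁻ y, D x y ∂μ ∂μ with hI
  have hMle : M ≤ (∑ i ∈ Finset.range m, ∑ j ∈ Finset.range m,
        cellWeight μ κ i * cellWeight μ κ j) * I := by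
    rw [Finset.sum_mul]
    refine Finset.sum_le_sum fun i _ => ?_
    rw [Finset.sum_mul]
    refine Finset.sum_le_sum fun j _ => ?_
    calc _ ≤ ∫⁻ z, cellWeight μ κ j * ∫⁻ w, D z w ∂μ ∂cellMeasure μ κ i :=
          lintegral_mono fun z => lintegral_cellMeasure_le μ κ j _
      _ ≤ cellWeight μ κ i * ∫⁻ z, cellWeight μ κ j * ∫⁻ w, D z w ∂μ ∂μ :=
          lintegral_cellMeasure_le μ κ i _
      _ = _ := by rw [lintegral_const_mul' _ _ (cellWeight_ne_top μ κ j), ← mul_assoc]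
  have hBs : Measurable fun x => B x (s (κ x)) :=
    hB.comp (measurable_id.prodMk (measurable_from_nat.comp hκ))
  have pt : ∀ x, ∫⁻ z, (A x z + B x z) ∂cellMeasure μ κ (κ x) ≤
      2 * B x (s (κ x)) + (2 * ∫⁻ z, B z (s (κ x)) ∂cellMeasure μ κ (κ x) +
        (∑ i ∈ Finset.range m, cellWeight μ κ i) * ∫⁻ z, D x z ∂μ) := by
    intro x
    have hBx : Measurable fun z => B z (s (κ x)) := hB.comp measurable_prodMk_right
    calc _ ≤ ∫⁻ z, (2 * B x (s (κ x)) + (2 * B z (s (κ x)) + D x z)) ∂cellMeasure μ κ (κ x) := by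
          refine lintegral_mono fun z => ?_
          calc A x z + B x z ≤ (B x z + D x z) + B x z := by gcongr; exact hAB x z
            _ = 2 * B x z + D x z := by ring
            _ ≤ 2 * (B x (s (κ x)) + B (s (κ x)) z) + D x z := by gcongr; exact tB _ _ _
            _ = _ := by rw [sB _ z]; ring
      _ = 2 * B x (s (κ x)) * cellMeasure μ κ (κ x) Set.univ +
            (2 * ∫⁻ z, B z (s (κ x)) ∂cellMeasure μ κ (κ x) +
              ∫⁻ z, D x z ∂cellMeasure μ κ (κ x)) := by
          rw [lintegral_add_left measurable_const, lintegral_add_left (hBx.const_mul 2),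
            lintegral_const_mul _ hBx, lintegral_const]
      _ ≤ _ := by
          refine add_le_add ?_ (add_le_add le_rfl ?_)
          · calc _ ≤ 2 * B x (s (κ x)) * 1 := mul_le_mul_right prob_le_one _
              _ = _ := mul_one _
          · refine (lintegral_cellMeasure_le μ κ _ _).trans ?_
            gcongr
            exact Finset.single_le_sum (f := fun i => cellWeight μ κ i)
              (fun _ _ => zero_le) (Finset.mem_range.2 (hm x))
  calc ∫⁻ x, cellError μ κ m A B D x ∂μ
      ≤ ∫⁻ x, (2 * B x (s (κ x)) + (2 * ∫⁻ z, B z (s (κ x)) ∂cellMeasure μ κ (κ x) +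
        (∑ i ∈ Finset.range m, cellWeight μ κ i) * ∫⁻ z, D x z ∂μ) + M) ∂μ := by
        refine lintegral_mono_ae ?_
        filter_upwards [hnull] with x hx
        rw [cellError, if_neg hx]
        gcongr
        exact pt x
    _ = 2 * ∫⁻ x, B x (s (κ x)) ∂μ +
          (2 * ∫⁻ x, ∫⁻ z, B z (s (κ x)) ∂cellMeasure μ κ (κ x) ∂μ +
          (∑ i ∈ Finset.range m, cellWeight μ κ i) * I) + M := by
        have hDm : Measurable fun x => ∫⁻ z, D x z ∂μ := hD.lintegral_prod_right'
        rw [lintegral_add_right _ measurable_const, lintegral_add_left (hBs.const_mul 2),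
          lintegral_add_right _ (hDm.const_mul _), lintegral_const_mul _ hBs,
          lintegral_const_mul' _ _ ENNReal.ofNat_ne_top, lintegral_const_mul _ hDm]
        simp [hI]
    _ ≤ 2 * ∫⁻ x, B x (s (κ x)) ∂μ + (2 * ∫⁻ x, B x (s (κ x)) ∂μ +
          (∑ i ∈ Finset.range m, cellWeight μ κ i) * I) + (∑ i ∈ Finset.range m,
            ∑ j ∈ Finset.range m, cellWeight μ κ i * cellWeight μ κ j) * I := by
        have := lintegral_lintegral_cellMeasure_le μ hκ fun i z => B z (s i)
        exact add_le_add (add_le_add le_rfl (add_le_add (mul_le_mul_right this _) le_rfl)) hMle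
    _ = _ := by ring

end CellAverages

/-- Semimetrics that converge to an admissible metric in the mean converge to it up to sums
`φ x + φ y` with small integral. -/
theorem IsAdmissibleMetric.eventually_comparison {X : Type*} [MeasurableSpace X] {μ : Measure X}
    [IsProbabilityMeasure μ] {ρ : X → X → ℝ} (hρ : IsAdmissibleMetric μ ρ)
    {d : ℕ → X → X → ℝ} (hd : ∀ n, IsSemimetric (d n))
    (hm : ∀ n, Measurable (Function.uncurry (d n)))
    (hlim : Tendsto (fun n => ∫⁻ x, ∫⁻ y, ENNReal.ofReal |d n x y - ρ x y| ∂μ ∂μ) atTop (𝓝 0))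
    {ε : ℝ≥0∞} (hε : ε ≠ 0) :
    ∀ᶠ n in atTop, ∃ φ : X → ℝ≥0∞, Measurable φ ∧ ∫⁻ x, φ x ∂μ ≤ ε ∧ ∀ x y,
      ENNReal.ofReal (d n x y) ≤ ENNReal.ofReal (ρ x y) + (φ x + φ y) ∧
      ENNReal.ofReal (ρ x y) ≤ ENNReal.ofReal (d n x y) + (φ x + φ y) := by
  have hε2 : ε / 2 ≠ 0 := (ENNReal.half_pos hε).ne'
  obtain ⟨m, s, κ, hκ, hκm, hint⟩ := hρ.exists_quantization (μ := μ) (ε := ε / 2 / 4)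
    (ENNReal.div_pos hε2 ENNReal.ofNat_ne_top).ne'
  -- The quantization is chosen from `ρ` and `ε` alone, so `W` is a finite constant independent of
  -- `n`, and `n` is taken large afterwards.
  set W := ∑ i ∈ Finset.range m, cellWeight μ κ i + ∑ i ∈ Finset.range m, ∑ j ∈ Finset.range m,
        cellWeight μ κ i * cellWeight μ κ j with hW
  have hWt : W ≠ ∞ := by
    refine ENNReal.add_ne_top.2 ⟨ENNReal.sum_ne_top.2 fun i _ => cellWeight_ne_top μ κ i,
      ENNReal.sum_ne_top.2 fun i _ => ENNReal.sum_ne_top.2 fun j _ =>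
        ENNReal.mul_ne_top (cellWeight_ne_top μ κ i) (cellWeight_ne_top μ κ j)⟩
  have hlim' := ENNReal.Tendsto.const_mul hlim (Or.inr hWt)
  rw [mul_zero] at hlim'
  filter_upwards [hlim'.eventually (ge_mem_nhds hε2.bot_lt)] with n hn
  have hDm : Measurable (Function.uncurry fun x y => ENNReal.ofReal |d n x y - ρ x y|) :=
    ((hm n).sub hρ.measurable).abs.ennreal_ofReal
  have hAm : Measurable (Function.uncurry fun x y => ENNReal.ofReal (d n x y)) :=
    (hm n).ennreal_ofReal
  refine ⟨cellError μ κ m (fun x y => ENNReal.ofReal (d n x y)) (fun x y => ENNReal.ofReal (ρ x y))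
    (fun x y => ENNReal.ofReal |d n x y - ρ x y|),
    measurable_cellError μ hκ m hAm hρ.measurable_ofReal _, ?_, fun x y => ⟨?_, ?_⟩⟩
  · refine (lintegral_cellError_le μ hκ hκm hρ.measurable_ofReal hDm
      (fun x y => by rw [hρ.symm]) hρ.ofReal_triangle
      (fun x y => ofReal_le_ofReal_add_abs _ _) s).trans ?_
    calc _ ≤ 4 * (ε / 2 / 4) + ε / 2 := by gcongr
      _ = ε := by
        rw [ENNReal.mul_div_cancel (by norm_num) (by norm_num), ENNReal.add_halves]
  · exact le_add_cellError μ hκm hAm hρ.measurable_ofReal (fun x y => by rw [(hd n).symm])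
      (hd n).ofReal_triangle (fun x y => by rw [hρ.symm]) hρ.ofReal_triangle
      (fun x y => ofReal_le_ofReal_add_abs _ _) x y
  · rw [cellError_comm]
    exact le_add_cellError μ hκm hρ.measurable_ofReal hAm (fun x y => by rw [hρ.symm])
      hρ.ofReal_triangle (fun x y => by rw [(hd n).symm]) (hd n).ofReal_triangle
      (fun x y => by rw [abs_sub_comm]; exact ofReal_le_ofReal_add_abs _ _) x y

/-! ### Any admissible metric dominates any other one up to a small error -/

section Domination

variable {X : Type*} [MeasurableSpace X]

/-- The cost `c` is dominated by multiples of the cost `b`, up to sums `φ x + φ y` with small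
integral. -/
def IsDominated (μ : Measure X) (b c : X → X → ℝ≥0∞) : Prop :=
  ∀ ε : ℝ≥0∞, ε ≠ 0 → ∃ (C : ℝ≥0∞) (φ : X → ℝ≥0∞), C ≠ ∞ ∧ Measurable φ ∧
    ∫⁻ x, φ x ∂μ ≤ ε ∧ ∀ x y, c x y ≤ C * b x y + (φ x + φ y)

/-- The cost that separates the points of `A` from the other ones. -/
def separation (A : Set X) (x y : X) : ℝ≥0∞ := open Classical in if (x ∈ A ↔ y ∈ A) then 0 else 1

variable {μ : Measure X} {b : X → X → ℝ≥0∞}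

theorem IsDominated.mono {c c' : X → X → ℝ≥0∞} (h : IsDominated μ b c')
    (hc : ∀ x y, c x y ≤ c' x y) : IsDominated μ b c := by
  intro ε hε
  obtain ⟨C, φ, h1, h2, h3, h4⟩ := h ε hε
  exact ⟨C, φ, h1, h2, h3, fun x y => (hc x y).trans (h4 x y)⟩

theorem IsDominated.add {c c' : X → X → ℝ≥0∞} (h : IsDominated μ b c) (h' : IsDominated μ b c') :
    IsDominated μ b (fun x y => c x y + c' x y) := by
  intro ε hε
  have hε2 : ε / 2 ≠ 0 := (ENNReal.half_pos hε).ne'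
  obtain ⟨C, φ, h1, h2, h3, h4⟩ := h _ hε2
  obtain ⟨C', φ', h1', h2', h3', h4'⟩ := h' _ hε2
  refine ⟨C + C', fun x => φ x + φ' x, ENNReal.add_ne_top.2 ⟨h1, h1'⟩, h2.add h2', ?_,
    fun x y => ?_⟩
  · rw [lintegral_add_left h2]
    exact (add_le_add h3 h3').trans (ENNReal.add_halves ε).le
  · calc _ ≤ _ := add_le_add (h4 x y) (h4' x y)
      _ = _ := by ring

theorem isDominated_zero : IsDominated μ b (fun _ _ => 0) := fun ε _ =>
  ⟨0, fun _ => 0, ENNReal.zero_ne_top, measurable_const, by simp, fun x y => by simp⟩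

theorem IsDominated.sum {ι : Type*} (s : Finset ι) {c : ι → X → X → ℝ≥0∞}
    (h : ∀ i ∈ s, IsDominated μ b (c i)) : IsDominated μ b (fun x y => ∑ i ∈ s, c i x y) := by
  classical
  induction s using Finset.induction_on with
  | empty => simpa using isDominated_zero
  | insert i s hi ih =>
    simp only [Finset.sum_insert hi]
    exact (h i (by simp)).add (ih fun j hj => h j (by simp [hj]))

theorem IsDominated.const_mul {c : X → X → ℝ≥0∞} (h : IsDominated μ b c) {M : ℝ≥0∞}
    (hM : M ≠ ∞) : IsDominated μ b (fun x y => M * c x y) := by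
  intro ε hε
  obtain ⟨C, φ, h1, h2, h3, h4⟩ := h (ε / M) (ENNReal.div_pos hε hM).ne'
  refine ⟨M * C, fun x => M * φ x, ENNReal.mul_ne_top hM h1, h2.const_mul M, ?_, fun x y => ?_⟩
  · rw [lintegral_const_mul _ h2]
    exact (mul_le_mul_right h3 _).trans ENNReal.mul_div_le
  · calc M * c x y ≤ M * (C * b x y + (φ x + φ y)) := mul_le_mul_right (h4 x y) _
      _ = _ := by ring

theorem IsDominated.of_approx {c : X → X → ℝ≥0∞}
    (h : ∀ ε : ℝ≥0∞, ε ≠ 0 → ∃ (c' : X → X → ℝ≥0∞) (φ : X → ℝ≥0∞), IsDominated μ b c' ∧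
      Measurable φ ∧ ∫⁻ x, φ x ∂μ ≤ ε ∧ ∀ x y, c x y ≤ c' x y + (φ x + φ y)) :
    IsDominated μ b c := by
  intro ε hε
  have hε2 : ε / 2 ≠ 0 := (ENNReal.half_pos hε).ne'
  obtain ⟨c', φ', hc', h2', h3', h4'⟩ := h _ hε2
  obtain ⟨C, φ, h1, h2, h3, h4⟩ := hc' _ hε2
  refine ⟨C, fun x => φ x + φ' x, h1, h2.add h2', ?_, fun x y => ?_⟩
  · rw [lintegral_add_left h2]
    exact (add_le_add h3 h3').trans (ENNReal.add_halves ε).le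
  · calc _ ≤ _ := (h4' x y).trans (add_le_add (h4 x y) le_rfl)
      _ = _ := by ring

/-- Measurable sets decreasing to the empty set have measure tending to zero, so their indicators
may be used as error functions. -/
theorem IsDominated.of_antitone [IsFiniteMeasure μ] {c : X → X → ℝ≥0∞} {c' : ℕ → X → X → ℝ≥0∞}
    (hc' : ∀ m, IsDominated μ b (c' m)) {R : ℕ → Set X} (hR : ∀ m, MeasurableSet (R m))
    (hanti : Antitone R) (hempty : ⋂ m, R m = ∅)
    (hle : ∀ m x y, c x y ≤ c' m x y + ((R m).indicator 1 x + (R m).indicator 1 y)) :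
    IsDominated μ b c := by
  refine IsDominated.of_approx fun ε hε => ?_
  have hlim := tendsto_measure_iInter_atTop (μ := μ) (fun m => (hR m).nullMeasurableSet) hanti
    ⟨0, measure_ne_top _ _⟩
  rw [hempty, measure_empty] at hlim
  obtain ⟨m, hm⟩ := (hlim.eventually (ge_mem_nhds hε.bot_lt)).exists
  refine ⟨c' m, (R m).indicator 1, hc' m, measurable_one.indicator (hR m), ?_, hle m⟩
  rw [lintegral_indicator_one (hR m)]
  exact hm

omit [MeasurableSpace X] in
theorem separation_le_one (A : Set X) (x y : X) : separation A x y ≤ 1 := by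
  unfold separation
  split_ifs <;> simp

omit [MeasurableSpace X] in
theorem separation_eq_one {A : Set X} {x y : X} (h : ¬ (x ∈ A ↔ y ∈ A)) : separation A x y = 1 := by
  unfold separation
  rw [if_neg h]

omit [MeasurableSpace X] in
theorem separation_congr {A B : Set X} {x y x' y' : X}
    (h : (x ∈ A ↔ y ∈ A) ↔ (x' ∈ B ↔ y' ∈ B)) : separation A x y = separation B x' y' := by
  unfold separation
  by_cases hA : x ∈ A ↔ y ∈ A
  · rw [if_pos hA, if_pos (h.1 hA)]
  · rw [if_neg hA, if_neg (mt h.2 hA)]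

omit [MeasurableSpace X] in
theorem separation_compl (A : Set X) : separation Aᶜ = separation A := by
  ext x y
  exact separation_congr (by simp only [Set.mem_compl_iff, not_iff_not])

omit [MeasurableSpace X] in
theorem separation_le {A : Set X} {B : X → X → ℝ≥0∞} (hB : ∀ x y, B x y = B y x)
    (h : ∀ x y, x ∈ A → y ∉ A → 1 ≤ B x y) (x y : X) : separation A x y ≤ B x y := by
  by_cases hx : x ∈ A <;> by_cases hy : y ∈ A
  · simp [separation, hx, hy]
  · exact (separation_le_one A x y).trans (h x y hx hy)
  · rw [hB]
    exact (separation_le_one A x y).trans (h y x hy hx)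
  · simp [separation, hx, hy]

omit [MeasurableSpace X] in
theorem separation_comm (A : Set X) (x y : X) : separation A x y = separation A y x :=
  separation_congr iff_comm

/-- A finite partial union is separated by the sum of the separations of its members; the rest of
the union shrinks to the empty set and goes into the error. -/
theorem IsDominated.separation_iUnion [IsFiniteMeasure μ] {A : ℕ → Set X}
    (hA : ∀ i, MeasurableSet (A i)) (h : ∀ i, IsDominated μ b (separation (A i))) :
    IsDominated μ b (separation (⋃ i, A i)) := by
  refine IsDominated.of_antitone (R := fun m => (⋃ i, A i) \ ⋃ i ∈ Finset.range m, A i)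
    (fun m => IsDominated.sum (Finset.range m) fun i _ => h i)
    (fun m => (MeasurableSet.iUnion hA).diff
      (Finset.measurableSet_biUnion _ fun i _ => hA i)) ?_ ?_ fun m => separation_le ?_ ?_
  · intro m n hmn
    refine Set.sdiff_subset_sdiff_right (Set.biUnion_subset_biUnion_left ?_)
    intro i hi
    simp only [Finset.coe_range, Set.mem_Iio] at hi ⊢
    omega
  · ext x
    simp only [Set.mem_iInter, Set.mem_sdiff, Set.mem_empty_iff_false, iff_false, not_forall]
    by_cases hx : x ∈ ⋃ i, A i
    · obtain ⟨i, hi⟩ := Set.mem_iUnion.1 hx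
      refine ⟨i + 1, fun h => h.2 (Set.mem_biUnion (x := i) ?_ hi)⟩
      simp
    · exact ⟨0, fun h => hx h.1⟩
  · intro x y
    simp only [separation_comm _ x y, add_comm]
  · intro x y hx hy
    by_cases hxm : x ∈ ⋃ i ∈ Finset.range m, A i
    · obtain ⟨i, hi, hxi⟩ := Set.mem_iUnion₂.1 hxm
      have hyi : y ∉ A i := fun h => hy (Set.mem_iUnion.2 ⟨i, h⟩)
      have h1 : separation (A i) x y = 1 := separation_eq_one (by simp [hxi, hyi])
      calc (1 : ℝ≥0∞) = separation (A i) x y := h1.symm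
        _ ≤ ∑ i ∈ Finset.range m, separation (A i) x y :=
          Finset.single_le_sum (f := fun i => separation (A i) x y) (fun _ _ => zero_le) hi
        _ ≤ _ := le_self_add
    · rw [Set.indicator_of_mem (show x ∈ (⋃ i, A i) \ ⋃ i ∈ Finset.range m, A i from ⟨hx, hxm⟩)]
      exact le_add_left le_self_add

/-- Outside the thin shell `r - 1/(m+1) < ρ x s < r`, a point of the ball and a point of its
complement are at distance at least `1/(m+1)`, so `(m+1) ρ` dominates the separation. The shells
shrink to the empty set because the ball is open. -/
theorem isDominated_separation_ball [IsFiniteMeasure μ] {ρ : X → X → ℝ} (hρ : IsSemimetric ρ)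
    (hm : Measurable (Function.uncurry ρ)) (s : X) (r : ℝ) :
    IsDominated μ (fun x y => ENNReal.ofReal (ρ x y)) (separation {x | ρ x s < r}) := by
  have hms : Measurable fun x => ρ x s := hm.comp measurable_prodMk_right
  refine IsDominated.of_antitone (R := fun m : ℕ => {x | r - 1 / (m + 1) < ρ x s} ∩ {x | ρ x s < r})
    (c' := fun m x y => ENNReal.ofReal (m + 1) * ENNReal.ofReal (ρ x y))
    (fun m ε hε => ⟨ENNReal.ofReal (m + 1), 0, ENNReal.ofReal_ne_top, measurable_const, by simp,
      fun x y => by simp⟩)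
    (fun m => (measurableSet_lt measurable_const hms).inter (measurableSet_lt hms measurable_const))
    ?_ ?_ fun m => separation_le ?_ ?_
  · intro m n hmn
    refine Set.inter_subset_inter_left _ fun x hx => ?_
    simp only [Set.mem_ofPred_eq] at hx ⊢
    have : (1 : ℝ) / (n + 1) ≤ 1 / (m + 1) := by gcongr
    linarith
  · ext x
    simp only [Set.mem_iInter, Set.mem_inter_iff, Set.mem_ofPred_eq, Set.mem_empty_iff_false,
      iff_false, not_forall]
    by_cases hx : ρ x s < r
    · obtain ⟨m, hm⟩ := exists_nat_one_div_lt (sub_pos.2 hx)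
      exact ⟨m, fun h => by linarith [h.1]⟩
    · exact ⟨0, fun h => hx h.2⟩
  · intro x y
    simp only [hρ.symm x y, add_comm]
  · intro x y hx hy
    simp only [Set.mem_ofPred_eq, not_lt] at hx hy
    by_cases hxm : r - 1 / (m + 1) < ρ x s
    · rw [Set.indicator_of_mem (show x ∈ {x | r - 1 / ((m : ℝ) + 1) < ρ x s} ∩ {x | ρ x s < r} from
        ⟨hxm, hx⟩)]
      exact le_add_left le_self_add
    · refine le_trans ?_ le_self_add
      have hm1 : (0 : ℝ) < m + 1 := by positivity
      rw [← ENNReal.ofReal_mul hm1.le, ← ENNReal.ofReal_one]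
      refine ENNReal.ofReal_le_ofReal ?_
      have h1 := hρ.triangle y x s
      rw [hρ.symm y x] at h1
      rw [← div_le_iff₀' hm1]
      linarith

/-- The sets that are uniformly separated from their complement, up to small errors. -/
@[reducible]
def dominatedAlgebra (μ : Measure X) [IsFiniteMeasure μ] (b : X → X → ℝ≥0∞) : MeasurableSpace X where
  MeasurableSet' A := MeasurableSet A ∧ IsDominated μ b (separation A)
  measurableSet_empty := ⟨MeasurableSet.empty, isDominated_zero.mono fun x y => by
    simp [separation]⟩
  measurableSet_compl A hA := ⟨hA.1.compl, by rw [separation_compl]; exact hA.2⟩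
  measurableSet_iUnion A hA := ⟨MeasurableSet.iUnion fun i => (hA i).1,
    IsDominated.separation_iUnion (fun i => (hA i).1) fun i => (hA i).2⟩

theorem isDominated_separation_preimage [IsFiniteMeasure μ] {F : X → ℕ → ℝ}
    (h : ∀ i, Measurable[dominatedAlgebra μ b] fun x => F x i) {U : Set (ℕ → ℝ)}
    (hU : MeasurableSet U) : IsDominated μ b (separation (F ⁻¹' U)) :=
  ((@measurable_pi_iff X ℕ (fun _ => ℝ) (dominatedAlgebra μ b) _ F).2 h hU).2

/-- Measurable sets are approximated by sets that are uniformly separated from their complement: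
the Borel structure is generated by the balls of the metric. -/
theorem IsAdmissibleMetric.isDominated_separation [StandardBorelSpace X] [IsProbabilityMeasure μ]
    {ρ : X → X → ℝ} (hρ : IsAdmissibleMetric μ ρ) {A : Set X} (hA : MeasurableSet A) :
    IsDominated μ (fun x y => ENNReal.ofReal (ρ x y)) (separation A) := by
  obtain ⟨s, hs⟩ := hρ.exists_dense_seq
  -- The distances to the dense sequence determine a point of the full-measure set `X₀`, so `F` is
  -- injective there.
  let F : X → ℕ → ℝ := fun x i => ρ x (s i)
  have hFi : ∀ i, Measurable fun x => ρ x (s i) := fun i =>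
    hρ.measurable.comp measurable_prodMk_right
  have hF : Measurable F := measurable_pi_iff.2 hFi
  set X₀ : Set X := {x | ∀ k : ℕ, ∃ n, ρ x (s n) < 1 / ((k : ℝ) + 1)} with hX₀
  have hX₀m : MeasurableSet X₀ := by
    have : X₀ = ⋂ k : ℕ, ⋃ n, {x | ρ x (s n) < 1 / ((k : ℝ) + 1)} := by
      ext x
      simp [hX₀]
    rw [this]
    exact MeasurableSet.iInter fun k => MeasurableSet.iUnion fun n =>
      measurableSet_lt (hFi n) measurable_const
  have hX₀μ : μ X₀ᶜ = 0 := by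
    rw [← mem_ae_iff]
    filter_upwards [hs] with x hx k
    exact hx _ (by positivity)
  have hinj : Set.InjOn F X₀ := by
    intro x hx y _ hxy
    refine hρ.eq_of_eq_zero x y (le_antisymm (le_of_forall_pos_lt_add fun ε hε => ?_)
      (hρ.nonneg x y))
    obtain ⟨k, hk⟩ := exists_nat_one_div_lt (half_pos hε)
    obtain ⟨n, hn⟩ := hx k
    have h1 : ρ x (s n) = ρ y (s n) := congrFun hxy n
    have h2 := hρ.triangle x (s n) y
    rw [hρ.symm (s n) y] at h2
    linarith
  -- By the Lusin–Souslin theorem an injective measurable image in a standard Borel setting is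
  -- measurable. Thus, up to a null set, `A` is the preimage under `F` of a measurable set, hence
  -- belongs to the σ-algebra generated by the balls.
  have himg : MeasurableSet (F '' (A ∩ X₀)) :=
    (hA.inter hX₀m).image_of_measurable_injOn hF (hinj.mono Set.inter_subset_right)
  have hdom : IsDominated μ (fun x y => ENNReal.ofReal (ρ x y))
      (separation (F ⁻¹' (F '' (A ∩ X₀)))) := by
    refine isDominated_separation_preimage (fun i => ?_) himg
    refine @measurable_of_Iio ℝ X _ _ _ (dominatedAlgebra μ _) _ _ _ _ fun r => ?_
    exact ⟨measurableSet_lt (hFi i) measurable_const,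
      isDominated_separation_ball hρ.toIsSemimetric hρ.measurable (s i) r⟩
  have hiff : ∀ x ∈ X₀, x ∈ F ⁻¹' (F '' (A ∩ X₀)) ↔ x ∈ A := by
    intro x hx
    constructor
    · rintro ⟨y, hy, hyx⟩
      rw [← hinj hy.2 hx hyx]
      exact hy.1
    · exact fun h => ⟨x, ⟨h, hx⟩, rfl⟩
  refine IsDominated.of_approx fun ε hε => ⟨_, X₀ᶜ.indicator 1, hdom,
    measurable_one.indicator hX₀m.compl, ?_, ?_⟩
  · rw [lintegral_indicator_one hX₀m.compl, hX₀μ]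
    exact zero_le
  · intro x y
    by_cases hx : x ∈ X₀
    · by_cases hy : y ∈ X₀
      · have : separation A x y = separation (F ⁻¹' (F '' (A ∩ X₀))) x y :=
          separation_congr (by rw [hiff x hx, hiff y hy])
        rw [this]
        exact le_self_add
      · rw [Set.indicator_of_mem (show y ∈ X₀ᶜ from hy)]
        exact (separation_le_one A x y).trans (le_add_left le_add_self)
    · rw [Set.indicator_of_mem (show x ∈ X₀ᶜ from hx)]
      exact (separation_le_one A x y).trans (le_add_left le_self_add)

/-- After quantization, `ρ` takes finitely many values on pairs of centres and vanishes within a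
cell. Hence it is bounded by a constant times the sum of the separations of the cells, each of which
`ρ'` dominates. -/
theorem IsAdmissibleMetric.isDominated [StandardBorelSpace X] [IsProbabilityMeasure μ]
    {ρ' ρ : X → X → ℝ} (hρ' : IsAdmissibleMetric μ ρ') (hρ : IsAdmissibleMetric μ ρ) :
    IsDominated μ (fun x y => ENNReal.ofReal (ρ' x y)) (fun x y => ENNReal.ofReal (ρ x y)) := by
  refine IsDominated.of_approx fun ε hε => ?_
  obtain ⟨m, s, κ, hκ, hκm, hint⟩ := hρ.exists_quantization hε
  set M : ℝ≥0∞ := ∑ i ∈ Finset.range m, ∑ j ∈ Finset.range m, ENNReal.ofReal (ρ (s i) (s j)) with hM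
  have hMt : M ≠ ∞ :=
    ENNReal.sum_ne_top.2 fun i _ => ENNReal.sum_ne_top.2 fun j _ => ENNReal.ofReal_ne_top
  refine ⟨fun x y => M * ∑ i ∈ Finset.range m, separation (κ ⁻¹' {i}) x y,
    fun x => ENNReal.ofReal (ρ x (s (κ x))),
    (IsDominated.sum _ fun i _ =>
      hρ'.isDominated_separation (hκ (measurableSet_singleton i))).const_mul hMt, ?_, hint, ?_⟩
  · exact hρ.measurable_ofReal.comp (measurable_id.prodMk (measurable_from_nat.comp hκ))
  · intro x y
    have key : ENNReal.ofReal (ρ (s (κ x)) (s (κ y))) ≤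
        M * ∑ i ∈ Finset.range m, separation (κ ⁻¹' {i}) x y := by
      by_cases hxy : κ x = κ y
      · rw [hxy, hρ.self_eq_zero]
        simp
      · have h1 : separation (κ ⁻¹' {κ x}) x y = 1 :=
          separation_eq_one (by simp [Ne.symm hxy])
        have h2 : (1 : ℝ≥0∞) ≤ ∑ i ∈ Finset.range m, separation (κ ⁻¹' {i}) x y := by
          rw [← h1]
          exact Finset.single_le_sum (f := fun i => separation (κ ⁻¹' {i}) x y)
            (fun _ _ => zero_le) (Finset.mem_range.2 (hκm x))
        have h3 : ENNReal.ofReal (ρ (s (κ x)) (s (κ y))) ≤ M := by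
          refine le_trans ?_ (Finset.single_le_sum (fun _ _ => zero_le)
            (Finset.mem_range.2 (hκm x)))
          exact Finset.single_le_sum (f := fun j => ENNReal.ofReal (ρ (s (κ x)) (s j)))
            (fun _ _ => zero_le) (Finset.mem_range.2 (hκm y))
        calc _ ≤ M * 1 := by rwa [mul_one]
          _ ≤ _ := mul_le_mul_right h2 _
    calc ENNReal.ofReal (ρ x y) ≤ ENNReal.ofReal (ρ x (s (κ x))) +
          (ENNReal.ofReal (ρ (s (κ x)) (s (κ y))) + ENNReal.ofReal (ρ y (s (κ y)))) := by
          refine (hρ.ofReal_triangle x (s (κ x)) y).trans (add_le_add le_rfl ?_)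
          rw [hρ.symm y]
          exact hρ.ofReal_triangle _ _ _
      _ ≤ ENNReal.ofReal (ρ x (s (κ x))) + (M * ∑ i ∈ Finset.range m, separation (κ ⁻¹' {i}) x y +
          ENNReal.ofReal (ρ y (s (κ y)))) := by gcongr
      _ = _ := by ring

end Domination

/-! ### Kantorovich transfer of costs -/

/-- For every coupling, `φ p.1 + φ p.2` has the same integral, determined by the marginals. The
constant must be nonzero and finite to commute with the infimum, which might be over an empty
family. -/
theorem kantorovich_le_of_le {Z : Type*} [MeasurableSpace Z] {c c' : Z → Z → ℝ≥0∞} {C : ℝ≥0∞}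
    (hC₀ : C ≠ 0) (hC : C ≠ ∞) {φ : Z → ℝ≥0∞} (hφ : Measurable φ)
    (h : ∀ x y, c x y ≤ C * c' x y + (φ x + φ y)) (α β : Measure Z) :
    kantorovich c α β ≤ C * kantorovich c' α β + (∫⁻ x, φ x ∂α + ∫⁻ x, φ x ∂β) := by
  unfold kantorovich
  simp_rw [ENNReal.mul_iInf_of_ne hC₀ hC, ENNReal.iInf_add]
  refine le_iInf₂ fun ψ hψ => iInf₂_le_of_le ψ hψ ?_
  have h1 : Measurable fun p : Z × Z => φ p.1 := hφ.comp measurable_fst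
  have h2 : Measurable fun p : Z × Z => φ p.2 := hφ.comp measurable_snd
  calc ∫⁻ p, c p.1 p.2 ∂ψ ≤ ∫⁻ p, (C * c' p.1 p.2 + (φ p.1 + φ p.2)) ∂ψ :=
        lintegral_mono fun p => h p.1 p.2
    _ = C * ∫⁻ p, c' p.1 p.2 ∂ψ + (∫⁻ p, φ p.1 ∂ψ + ∫⁻ p, φ p.2 ∂ψ) := by
        rw [lintegral_add_right _ (show Measurable fun p : Z × Z => φ p.1 + φ p.2 from h1.add h2), lintegral_const_mul' _ _ hC, lintegral_add_left h1]
    _ = _ := by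
        rw [← hψ.1, ← hψ.2, lintegral_map hφ measurable_fst, lintegral_map hφ measurable_snd]

/-! ### Conditional measures and transfer of error terms. -/

section CondExpKernel

variable {X : Type*} {m : MeasurableSpace X} [mX : MeasurableSpace X] [StandardBorelSpace X]
  {μ : Measure X} [IsFiniteMeasure μ]

theorem measurable_condExpKernel_of_le (hm : m ≤ mX) :
    Measurable fun x => (condExpKernel μ m x : Measure X) :=
  (condExpKernel μ m).measurable.mono hm le_rfl

theorem bind_condExpKernel (hm : m ≤ mX) : μ.bind (fun x => condExpKernel μ m x) = μ := by
  ext s hs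
  rw [Measure.bind_apply hs (measurable_condExpKernel_of_le hm).aemeasurable]
  conv_rhs => rw [← condExpKernel_comp_trim (μ := μ) hm]
  rw [Measure.bind_apply hs (condExpKernel μ m).measurable.aemeasurable,
    lintegral_trim hm (measurable_condExpKernel hs)]

theorem lintegral_condExpKernel (hm : m ≤ mX) {φ : X → ℝ≥0∞} (hφ : Measurable φ) :
    ∫⁻ x, ∫⁻ y, φ y ∂condExpKernel μ m x ∂μ = ∫⁻ x, φ x ∂μ := by
  conv_rhs => rw [← bind_condExpKernel (μ := μ) hm]
  rw [Measure.lintegral_bind (measurable_condExpKernel_of_le hm).aemeasurable hφ.aemeasurable]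

theorem ae_ae_condExpKernel (hm : m ≤ mX) {p : X → Prop} (h : ∀ᵐ x ∂μ, p x) :
    ∀ᵐ x ∂μ, ∀ᵐ y ∂condExpKernel μ m x, p y := by
  rw [← bind_condExpKernel (μ := μ) hm] at h
  exact Measure.ae_ae_of_ae_bind (measurable_condExpKernel_of_le hm).aemeasurable h

theorem ae_condExpKernel_mem (hm : m ≤ mX) {A : Set X} (hA : MeasurableSet[m] A) :
    ∀ᵐ x ∂μ, x ∈ A → ∀ᵐ y ∂condExpKernel μ m x, y ∈ A := by
  have hA' : MeasurableSet[m] Aᶜ := hA.compl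
  have h1 := condExpKernel_ae_eq_condExp (μ := μ) hm (hm _ hA')
  rw [condExp_of_stronglyMeasurable hm ((stronglyMeasurable_const (b := (1 : ℝ))).indicator hA')
    ((integrable_const _).indicator (hm _ hA'))] at h1
  filter_upwards [h1] with x hx hxA
  rw [Set.indicator_of_notMem (by simpa using hxA)] at hx
  rw [ae_iff]
  exact (measureReal_eq_zero_iff).1 hx

/-- The new error is the conditional mean of the old one, so its integral does not grow and the step
can be iterated without loss. -/
theorem transfer_le_of_le (hm : m ≤ mX) {c c' : X → X → ℝ≥0∞} {C : ℝ≥0∞}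
    (hC₀ : C ≠ 0) (hC : C ≠ ∞) {φ : X → ℝ≥0∞} (hφ : Measurable φ)
    (h : ∀ x y, c x y ≤ C * c' x y + (φ x + φ y)) :
    ∃ φ' : X → ℝ≥0∞, Measurable φ' ∧ ∫⁻ x, φ' x ∂μ = ∫⁻ x, φ x ∂μ ∧
      ∀ x y, transfer m μ c x y ≤ C * transfer m μ c' x y + (φ' x + φ' y) :=
  ⟨fun x => ∫⁻ y, φ y ∂condExpKernel μ m x,
    (Measure.measurable_lintegral hφ).comp (measurable_condExpKernel_of_le hm),
    lintegral_condExpKernel hm hφ, fun _ _ => kantorovich_le_of_le hC₀ hC hφ h _ _⟩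

end CondExpKernel

/-! ### Iterated transfer and ergodicity. -/

section Iterates

variable {E : Type*} [MeasurableSpace E]

theorem tailAlgebra_le (n : ℕ) :
    tailAlgebra E n ≤ (inferInstance : MeasurableSpace (ℕ → E)) :=
  Measurable.comap_le (measurable_pi_lambda _ fun _ => measurable_pi_apply _)

variable [StandardBorelSpace E] (μ : Measure (ℕ → E)) [IsFiniteMeasure μ]

/-- The cost `c` transferred successively along `𝔄₁, …, 𝔄ₙ`. -/
def iteratedCost (c : (ℕ → E) → (ℕ → E) → ℝ≥0∞) : ℕ → (ℕ → E) → (ℕ → E) → ℝ≥0∞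
  | 0 => c
  | n + 1 => transfer (tailAlgebra E (n + 1)) μ (iteratedCost c n)

theorem iteratedSemimetric_eq (ρ : (ℕ → E) → (ℕ → E) → ℝ) (n : ℕ) :
    iteratedSemimetric μ ρ n = iteratedCost μ (fun x y => ENNReal.ofReal (ρ x y)) n := by
  induction n with
  | zero => rfl
  | succ n ih => rw [iteratedSemimetric, iteratedCost, ih]

variable {μ}

theorem iteratedCost_le_of_le {c c' : (ℕ → E) → (ℕ → E) → ℝ≥0∞} {C : ℝ≥0∞}
    (hC₀ : C ≠ 0) (hC : C ≠ ∞) {φ : (ℕ → E) → ℝ≥0∞} (hφ : Measurable φ)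
    (h : ∀ x y, c x y ≤ C * c' x y + (φ x + φ y)) (n : ℕ) :
    ∃ φ' : (ℕ → E) → ℝ≥0∞, Measurable φ' ∧ ∫⁻ x, φ' x ∂μ = ∫⁻ x, φ x ∂μ ∧
      ∀ x y, iteratedCost μ c n x y ≤ C * iteratedCost μ c' n x y + (φ' x + φ' y) := by
  induction n with
  | zero => exact ⟨φ, hφ, rfl, h⟩
  | succ n ih =>
    obtain ⟨φ₁, h1, h2, h3⟩ := ih
    obtain ⟨φ₂, h1', h2', h3'⟩ := transfer_le_of_le (μ := μ) (tailAlgebra_le (n + 1)) hC₀ hC h1 h3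
    exact ⟨φ₂, h1', h2'.trans h2, h3'⟩

/-- The error is uniform in `n`. Measurability of the iterated costs is never needed: sums are split
along the measurable error term, and the constant is finite. -/
theorem lintegral_iteratedCost_le [IsProbabilityMeasure μ] {c c' : (ℕ → E) → (ℕ → E) → ℝ≥0∞}
    {C : ℝ≥0∞} (hC₀ : C ≠ 0) (hC : C ≠ ∞) {φ : (ℕ → E) → ℝ≥0∞} (hφ : Measurable φ)
    (h : ∀ x y, c x y ≤ C * c' x y + (φ x + φ y)) (n : ℕ) :
    ∫⁻ x, ∫⁻ y, iteratedCost μ c n x y ∂μ ∂μ ≤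
      C * ∫⁻ x, ∫⁻ y, iteratedCost μ c' n x y ∂μ ∂μ + 2 * ∫⁻ x, φ x ∂μ := by
  obtain ⟨φ', h1, h2, h3⟩ := iteratedCost_le_of_le (μ := μ) hC₀ hC hφ h n
  calc _ ≤ ∫⁻ x, ∫⁻ y, (C * iteratedCost μ c' n x y + (φ' x + φ' y)) ∂μ ∂μ :=
        lintegral_mono fun x => lintegral_mono fun y => h3 x y
    _ = ∫⁻ x, (C * ∫⁻ y, iteratedCost μ c' n x y ∂μ + (φ' x + ∫⁻ y, φ' y ∂μ)) ∂μ := by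
        refine lintegral_congr fun x => ?_
        rw [lintegral_add_right _ (h1.const_add _), lintegral_const_mul' _ _ hC,
          lintegral_add_left measurable_const]
        simp
    _ = _ := by
        rw [lintegral_add_right _ (h1.add_const _), lintegral_const_mul' _ _ hC,
          lintegral_add_left h1, h2]
        simp [two_mul]

theorem IsDominated.tendsto_iteratedCost [IsProbabilityMeasure μ]
    {c c' : (ℕ → E) → (ℕ → E) → ℝ≥0∞} (h : IsDominated μ c' c)
    (hlim : Tendsto (fun n => ∫⁻ x, ∫⁻ y, iteratedCost μ c' n x y ∂μ ∂μ) atTop (𝓝 0)) :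
    Tendsto (fun n => ∫⁻ x, ∫⁻ y, iteratedCost μ c n x y ∂μ ∂μ) atTop (𝓝 0) := by
  rw [ENNReal.tendsto_nhds_zero]
  intro ε hε
  have hε2 : ε / 2 ≠ 0 := (ENNReal.half_pos hε.ne').ne'
  obtain ⟨C, φ, hC, hφ, hint, hle⟩ := h (ε / 2 / 2) (ENNReal.half_pos hε2).ne'
  have hC1 : C + 1 ≠ ∞ := by finiteness
  have hlim' := ENNReal.Tendsto.const_mul hlim (Or.inr hC1)
  rw [mul_zero] at hlim'
  filter_upwards [hlim'.eventually (ge_mem_nhds hε2.bot_lt)] with n hn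
  -- `C + 1` replaces `C` to have a nonzero constant.
  refine (lintegral_iteratedCost_le (μ := μ) (C := C + 1) (c' := c') (by simp) hC1 hφ
    (fun x y => (hle x y).trans ?_) n).trans ?_
  · gcongr
    exact le_self_add
  · calc _ ≤ ε / 2 + 2 * (ε / 2 / 2) := by gcongr
      _ = ε := by
        rw [ENNReal.mul_div_cancel (by norm_num) (by norm_num), ENNReal.add_halves]

/-- A set in every tail algebra is respected by the conditional measures: from points on different
sides they live on different sides, so every coupling pays separation 1. The set `G` collects the
points at which this holds along with all earlier exceptional sets. -/
theorem separation_le_iteratedCost {A : Set (ℕ → E)} (hA : ∀ n, MeasurableSet[tailAlgebra E n] A)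
    (n : ℕ) : ∃ G : Set (ℕ → E), (∀ᵐ x ∂μ, x ∈ G) ∧
      ∀ x ∈ G, ∀ y ∈ G, separation A x y ≤ iteratedCost μ (separation A) n x y := by
  induction n with
  | zero => exact ⟨Set.univ, by simp, fun _ _ _ _ => le_rfl⟩
  | succ n ih =>
    obtain ⟨G, hG, hle⟩ := ih
    let Q := condExpKernel μ (tailAlgebra E (n + 1))
    refine ⟨{x | (∀ᵐ y ∂Q x, y ∈ G) ∧ (x ∈ A → ∀ᵐ y ∂Q x, y ∈ A) ∧
      (x ∈ Aᶜ → ∀ᵐ y ∂Q x, y ∈ Aᶜ)}, ?_, ?_⟩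
    · filter_upwards [ae_ae_condExpKernel (tailAlgebra_le (n + 1)) hG,
        ae_condExpKernel_mem (tailAlgebra_le (n + 1)) (hA (n + 1)),
        ae_condExpKernel_mem (tailAlgebra_le (n + 1)) (hA (n + 1)).compl] with x h1 h2 h3
      exact ⟨h1, h2, h3⟩
    · rintro x ⟨hx1, hx2, hx3⟩ y ⟨hy1, hy2, hy3⟩
      by_cases hxy : x ∈ A ↔ y ∈ A
      · simp [separation, hxy]
      refine le_iInf₂ fun ψ hψ => ?_
      have hfst : ∀ {p : (ℕ → E) → Prop}, (∀ᵐ x' ∂Q x, p x') → ∀ᵐ q ∂ψ, p q.1 := fun h =>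
        ae_of_ae_map measurable_fst.aemeasurable (by rw [hψ.1]; exact h)
      have hsnd : ∀ {p : (ℕ → E) → Prop}, (∀ᵐ x' ∂Q y, p x') → ∀ᵐ q ∂ψ, p q.2 := fun h =>
        ae_of_ae_map measurable_snd.aemeasurable (by rw [hψ.2]; exact h)
      have huniv : ψ Set.univ = 1 := by
        have := Measure.map_apply (μ := ψ) measurable_fst MeasurableSet.univ
        rw [hψ.1, measure_univ] at this
        exact this.symm
      have hsep : ∀ᵐ q ∂ψ, ¬ (q.1 ∈ A ↔ q.2 ∈ A) := by
        by_cases hx : x ∈ A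
        · have hy : y ∈ Aᶜ := fun h => hxy (by simp [hx, h])
          filter_upwards [hfst (hx2 hx), hsnd (hy3 hy)] with q h1 h2
          simp only [Set.mem_compl_iff] at h2
          tauto
        · have hy : y ∈ A := by tauto
          filter_upwards [hfst (hx3 hx), hsnd (hy2 hy)] with q h1 h2
          simp only [Set.mem_compl_iff] at h1
          tauto
      calc separation A x y ≤ 1 := separation_le_one A x y
        _ = ∫⁻ _, 1 ∂ψ := by simp [huniv]
        _ ≤ _ := by
          refine lintegral_mono_ae ?_
          filter_upwards [hsep, hfst hx1, hsnd hy1] with q h1 h2 h3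
          rw [← separation_eq_one h1]
          exact hle _ h2 _ h3

theorem isErgodicChain_of_tendsto [IsProbabilityMeasure μ] {ρ : (ℕ → E) → (ℕ → E) → ℝ}
    (hρ : IsAdmissibleMetric μ ρ)
    (hlim : Tendsto (fun n => ∫⁻ x, ∫⁻ y, iteratedSemimetric μ ρ n x y ∂μ ∂μ) atTop (𝓝 0)) :
    IsErgodicChain μ := by
  intro A hA
  have hA' : ∀ n, MeasurableSet[tailAlgebra E n] A := fun n => iInf_le (tailAlgebra E) n _ hA
  have hAm : MeasurableSet A := tailAlgebra_le 0 _ (hA' 0)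
  simp only [iteratedSemimetric_eq] at hlim
  have h1 := (hρ.isDominated_separation hAm).tendsto_iteratedCost hlim
  have h2 : ∫⁻ x, ∫⁻ y, separation A x y ∂μ ∂μ ≤ 0 := by
    refine ge_of_tendsto' h1 fun n => ?_
    obtain ⟨G, hG, hle⟩ := separation_le_iteratedCost (μ := μ) hA' n
    refine lintegral_mono_ae ?_
    filter_upwards [hG] with x hx
    refine lintegral_mono_ae ?_
    filter_upwards [hG] with y hy
    exact hle x hx y hy
  have hmeas : Measurable (Function.uncurry (separation A)) := by
    refine Measurable.ite ?_ measurable_const measurable_const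
    exact MeasurableSet.iff (measurable_fst hAm) (measurable_snd hAm)
  have h3 := (lintegral_eq_zero_iff hmeas.lintegral_prod_right').1 (le_antisymm h2 zero_le)
  -- The mean separation is zero, so almost every point lies on the same side of `A` as this `x`.
  obtain ⟨x, hx⟩ := h3.exists
  have hx' : ∀ᵐ y ∂μ, (x ∈ A ↔ y ∈ A) := by
    have := (lintegral_eq_zero_iff (hmeas.comp measurable_prodMk_left)).1 hx
    filter_upwards [this] with y hy
    by_contra h
    have := separation_eq_one h
    simp only [Function.comp_apply, Function.uncurry_apply_pair, Pi.zero_apply] at hy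
    rw [this] at hy
    exact one_ne_zero hy
  by_cases hxA : x ∈ A
  · right
    rw [← prob_compl_eq_zero_iff hAm]
    filter_upwards [hx'] with y hy
    simpa using hy.1 hxA
  · left
    refine measure_eq_zero_iff_ae_notMem.2 ?_
    filter_upwards [hx'] with y hy
    exact fun h => hxA (hy.2 h)

end Iterates

/-! ### Finitely supported measures -/

section FiniteSupport

variable {Z : Type*} [MeasurableSpace Z]

/-- The measure is carried by a finite set. -/
def IsFinitelySupported (θ : Measure Z) : Prop := ∃ S : Finset Z, θ (S : Set Z)ᶜ = 0

theorem IsFinitelySupported.of_absolutelyContinuous {θ θ' : Measure Z}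
    (h : IsFinitelySupported θ) (hθ : θ' ≪ θ) : IsFinitelySupported θ' := by
  obtain ⟨S, hS⟩ := h
  exact ⟨S, hθ hS⟩

theorem IsFinitelySupported.cond {θ : Measure Z} (h : IsFinitelySupported θ) (R : Set Z) :
    IsFinitelySupported (ProbabilityTheory.cond θ R) :=
  h.of_absolutelyContinuous cond_absolutelyContinuous

theorem IsFinitelySupported.of_isCoupling {α β : Measure Z} {ψ : Measure (Z × Z)}
    [MeasurableSingletonClass Z]
    (hα : IsFinitelySupported α) (hβ : IsFinitelySupported β) (hψ : IsCoupling α β ψ) :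
    IsFinitelySupported ψ := by
  obtain ⟨S, hS⟩ := hα
  obtain ⟨T, hT⟩ := hβ
  refine ⟨S ×ˢ T, ?_⟩
  rw [← hψ.1, Measure.map_apply measurable_fst S.measurableSet.compl] at hS
  rw [← hψ.2, Measure.map_apply measurable_snd T.measurableSet.compl] at hT
  refine measure_mono_null ?_ (measure_union_null hS hT)
  intro p hp
  simp only [Finset.coe_product, Set.mem_compl_iff, Set.mem_prod, not_and_or] at hp
  exact hp

variable [MeasurableSingletonClass Z] {θ : Measure Z}

theorem lintegral_eq_sum_of_support {S : Finset Z} (hS : θ (S : Set Z)ᶜ = 0) (f : Z → ℝ≥0∞) :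
    ∫⁻ z, f z ∂θ = ∑ z ∈ S, f z * θ {z} := by
  rw [← lintegral_finset, Measure.restrict_eq_self_of_ae_mem]
  exact mem_ae_iff.2 hS

theorem IsFinitelySupported.aemeasurable (h : IsFinitelySupported θ) (f : Z → ℝ≥0∞) :
    AEMeasurable f θ := by
  obtain ⟨S, hS⟩ := h
  refine ⟨(S : Set Z).indicator f, fun t ht => ?_, ?_⟩
  · by_cases h0 : (0 : ℝ≥0∞) ∈ t
    · rw [← compl_compl ((S : Set Z).indicator f ⁻¹' t)]
      refine (S.finite_toSet.subset fun z hz => ?_).measurableSet.compl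
      by_contra hzS
      exact hz (by simpa [Set.indicator_of_notMem hzS] using h0)
    · refine (S.finite_toSet.subset fun z hz => ?_).measurableSet
      by_contra hzS
      rw [Set.mem_preimage, Set.indicator_of_notMem hzS] at hz
      exact h0 hz
  · have : ∀ᵐ z ∂θ, z ∈ (S : Set Z) := mem_ae_iff.2 hS
    filter_upwards [this] with z hz
    rw [Set.indicator_of_mem hz]

omit [MeasurableSingletonClass Z] in
theorem IsFinitelySupported.ae_singleton_ne_zero (h : IsFinitelySupported θ) :
    ∀ᵐ z ∂θ, θ {z} ≠ 0 := by
  obtain ⟨S, hS⟩ := h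
  rw [ae_iff]
  have : {z | ¬ θ {z} ≠ 0} ⊆ (S : Set Z)ᶜ ∪ ⋃ z ∈ {z ∈ (S : Set Z) | θ {z} = 0}, {z} := by
    intro z hz
    by_cases hzS : z ∈ (S : Set Z)
    · right
      simp only [ne_eq, not_not, Set.mem_ofPred_eq] at hz
      exact Set.mem_biUnion (x := z) ⟨hzS, hz⟩ rfl
    · exact Or.inl hzS
  refine measure_mono_null this (measure_union_null hS ?_)
  rw [measure_biUnion_null_iff (S.countable_toSet.mono fun z hz => hz.1)]
  exact fun z hz => hz.2

/-- Averaging over the classes of an equivalence relation does not change the mean. -/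
theorem IsFinitelySupported.lintegral_lintegral_cond [IsFiniteMeasure θ]
    (h : IsFinitelySupported θ) {R : Z → Set Z} (hRm : ∀ p, MeasurableSet (R p))
    (hself : ∀ p, p ∈ R p) (hR : ∀ p q, q ∈ R p → R q = R p) (f : Z → ℝ≥0∞) :
    ∫⁻ p, ∫⁻ q, f q ∂ProbabilityTheory.cond θ (R p) ∂θ = ∫⁻ q, f q ∂θ := by
  classical
  obtain ⟨S, hS⟩ := h
  -- Written with the class of `q` instead of that of `p`: after exchanging the sums, the sum over
  -- `p` is then just the mass of the class of `q`.
  have hcond : ∀ p q, ProbabilityTheory.cond θ (R p) {q} =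
      (θ (R q))⁻¹ * (θ {q} * (R q).indicator 1 p) := by
    intro p q
    rw [cond_apply (hRm p)]
    by_cases hq : q ∈ R p
    · have hp : p ∈ R q := by rw [hR p q hq]; exact hself p
      rw [Set.indicator_of_mem hp, hR p q hq, Set.inter_eq_self_of_subset_right (by simpa using hq)]
      simp
    · have hp : p ∉ R q := fun hp => hq (by rw [hR q p hp]; exact hself q)
      rw [Set.indicator_of_notMem hp, Set.inter_singleton_eq_empty.2 hq]
      simp
  have hcS : ∀ p, ProbabilityTheory.cond θ (R p) (S : Set Z)ᶜ = 0 := fun p =>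
    cond_absolutelyContinuous hS
  rw [lintegral_eq_sum_of_support hS, lintegral_eq_sum_of_support hS]
  simp_rw [fun p => lintegral_eq_sum_of_support (hcS p) f, hcond, Finset.sum_mul]
  rw [Finset.sum_comm]
  refine Finset.sum_congr rfl fun q _ => ?_
  have hsum : ∑ p ∈ S, (R q).indicator 1 p * θ {p} = θ (R q) := by
    rw [← lintegral_eq_sum_of_support hS, lintegral_indicator_one (hRm q)]
  calc ∑ p ∈ S, f q * ((θ (R q))⁻¹ * (θ {q} * (R q).indicator 1 p)) * θ {p}
      = f q * ((θ (R q))⁻¹ * (θ {q} * ∑ p ∈ S, (R q).indicator 1 p * θ {p})) := by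
        simp only [Finset.mul_sum]
        refine Finset.sum_congr rfl fun p _ => by ring
    _ = f q * θ {q} := by
        rw [hsum]
        by_cases hq : θ (R q) = 0
        · have : θ {q} = 0 := measure_mono_null (by simpa using hself q) hq
          simp [this]
        · rw [mul_comm (θ {q}), ← mul_assoc (θ (R q))⁻¹,
            ENNReal.inv_mul_cancel hq (measure_ne_top _ _), one_mul]

end FiniteSupport

/-! ### Elementary facts on couplings. -/

section Couplings

variable {Z : Type*} [MeasurableSpace Z] {α β : Measure Z} {ψ : Measure (Z × Z)}

theorem IsCoupling.univ_eq (h : IsCoupling α β ψ) : ψ Set.univ = α Set.univ := by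
  rw [← h.1, Measure.map_apply measurable_fst MeasurableSet.univ, Set.preimage_univ]

theorem IsCoupling.isProbabilityMeasure [IsProbabilityMeasure α] (h : IsCoupling α β ψ) :
    IsProbabilityMeasure ψ := ⟨by rw [h.univ_eq, measure_univ]⟩

theorem IsCoupling.ae_fst (h : IsCoupling α β ψ) {p : Z → Prop} (hp : ∀ᵐ z ∂α, p z) :
    ∀ᵐ q ∂ψ, p q.1 :=
  ae_of_ae_map measurable_fst.aemeasurable (by rw [h.1]; exact hp)

theorem IsCoupling.ae_snd (h : IsCoupling α β ψ) {p : Z → Prop} (hp : ∀ᵐ z ∂β, p z) :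
    ∀ᵐ q ∂ψ, p q.2 :=
  ae_of_ae_map measurable_snd.aemeasurable (by rw [h.2]; exact hp)

theorem IsCoupling.fst_ne_zero [MeasurableSingletonClass Z] (h : IsCoupling α β ψ) {p : Z × Z}
    (hp : ψ {p} ≠ 0) : α {p.1} ≠ 0 := by
  rw [← h.1, Measure.map_apply measurable_fst (measurableSet_singleton _)]
  exact fun h0 => hp (measure_mono_null (by simp) h0)

theorem IsCoupling.snd_ne_zero [MeasurableSingletonClass Z] (h : IsCoupling α β ψ) {p : Z × Z}
    (hp : ψ {p} ≠ 0) : β {p.2} ≠ 0 := by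
  rw [← h.2, Measure.map_apply measurable_snd (measurableSet_singleton _)]
  exact fun h0 => hp (measure_mono_null (by simp) h0)

theorem isCoupling_prod [IsProbabilityMeasure α] [IsProbabilityMeasure β] :
    IsCoupling α β (α.prod β) := ⟨by simp, by simp⟩

/-- No optimal coupling is claimed to exist; the product coupling serves when the infimum is
infinite. -/
theorem exists_isCoupling_le [IsProbabilityMeasure α] [IsProbabilityMeasure β]
    (c : Z → Z → ℝ≥0∞) {ε : ℝ≥0∞} (hε : ε ≠ 0) :
    ∃ ψ, IsCoupling α β ψ ∧ ∫⁻ p, c p.1 p.2 ∂ψ ≤ kantorovich c α β + ε := by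
  by_cases h : kantorovich c α β = ∞
  · exact ⟨α.prod β, isCoupling_prod, by simp [h]⟩
  · have hlt : kantorovich c α β < kantorovich c α β + ε := ENNReal.lt_add_right h hε
    conv at hlt => lhs; unfold kantorovich
    obtain ⟨ψ, hψ⟩ := iInf_lt_iff.1 hlt
    obtain ⟨h1, h2⟩ := iInf_lt_iff.1 hψ
    exact ⟨ψ, h1, h2.le⟩

end Couplings

/-! ### The tree of branches -/

section Branches

variable {E : Type*} {n : ℕ}

theorem self_mem_branchesThrough (k : ℕ) (a : Fin n → E) : a ∈ branchesThrough k a :=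
  fun _ _ => rfl

theorem branchesThrough_eq {k : ℕ} {a b : Fin n → E} (h : b ∈ branchesThrough k a) :
    branchesThrough k b = branchesThrough k a := by
  ext u
  exact ⟨fun hu i hi => (hu i hi).trans (h i hi), fun hu i hi => (hu i hi).trans (h i hi).symm⟩

theorem branchesThrough_mono {j k : ℕ} (h : j ≤ k) (a : Fin n → E) :
    branchesThrough j a ⊆ branchesThrough k a := fun _ hu i hi => hu i (h.trans hi)

theorem branchesThrough_zero (a : Fin n → E) : branchesThrough 0 a = {a} := by
  ext u
  exact ⟨fun h => funext fun i => h i (Nat.zero_le _), fun h i _ => congrFun h i⟩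

theorem branchesThrough_of_le {k : ℕ} (h : n ≤ k) (a : Fin n → E) :
    branchesThrough k a = Set.univ :=
  Set.eq_univ_of_forall fun _ i hi => absurd (i.2.trans_le (h.trans hi)) (lt_irrefl _)

theorem disjoint_branchesThrough {k : ℕ} {a b : Fin n → E} (h : b ∉ branchesThrough k a) :
    Disjoint (branchesThrough k b) (branchesThrough k a) := by
  refine Set.disjoint_left.2 fun u hb ha => h ?_
  rw [← branchesThrough_eq ha, branchesThrough_eq hb]
  exact self_mem_branchesThrough k b

theorem measurableSet_branchesThrough [MeasurableSpace E] [MeasurableSingletonClass E] (k : ℕ)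
    (a : Fin n → E) : MeasurableSet (branchesThrough k a) := by
  have : branchesThrough k a = ⋂ i : Fin n, {u | k ≤ (i : ℕ) → u i = a i} := by
    ext u
    simp [branchesThrough]
  rw [this]
  refine MeasurableSet.iInter fun i => ?_
  by_cases hi : k ≤ (i : ℕ)
  · simp only [hi, true_imp_iff]
    have h : MeasurableSet ((fun u : Fin n → E => u i) ⁻¹' {a i}) :=
      measurable_pi_apply i (measurableSet_singleton (a i))
    exact h
  · simp [hi]

end Branches

/-! ### Markov couplings and iterated Kantorovich distances -/

section DynamicProgramming

variable {E : Type*} [MeasurableSpace E] [MeasurableSingletonClass E] {n : ℕ}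
  {α β : Measure (Fin n → E)} [IsProbabilityMeasure α] [IsProbabilityMeasure β]
  {c : (Fin n → E) → (Fin n → E) → ℝ≥0∞} {W : ℕ → (Fin n → E) → (Fin n → E) → ℝ≥0∞}

theorem cond_cond_branchesThrough {j k : ℕ} (hjk : j ≤ k) {a u : Fin n → E}
    (ha : a ∈ branchesThrough k u) :
    ProbabilityTheory.cond (ProbabilityTheory.cond α (branchesThrough k u)) (branchesThrough j a) =
      ProbabilityTheory.cond α (branchesThrough j a) := by
  rw [cond_cond_eq_cond_inter (measurableSet_branchesThrough _ _)
    (measurableSet_branchesThrough _ _), Set.inter_eq_self_of_subset_right]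
  exact (branchesThrough_mono hjk a).trans (branchesThrough_eq ha).subset

-- Induction from the leaves to the root. Conditioned on a pair of vertices, a Markov coupling is a
-- competitor in the Kantorovich problem with cost `W k`; there `W k` is bounded by the mean cost
-- over the next pair of vertices, and averaging these means gives back the mean over the larger
-- pair.
omit [IsProbabilityMeasure β] in
theorem le_lintegral_of_isMarkovCoupling (hα : IsFinitelySupported α) (hβ : IsFinitelySupported β)
    (h0 : ∀ u v, W 0 u v ≤ c u v)
    (hs : ∀ k < n, ∀ u v, α {u} ≠ 0 → β {v} ≠ 0 →
      W (k + 1) u v ≤ kantorovich (W k) (ProbabilityTheory.cond α (branchesThrough (k + 1) u))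
        (ProbabilityTheory.cond β (branchesThrough (k + 1) v)))
    {ψ : Measure ((Fin n → E) × (Fin n → E))} (hψ : IsMarkovCoupling α β ψ) {k : ℕ} (hk : k ≤ n)
    {u v : Fin n → E} (hu : α {u} ≠ 0) (hv : β {v} ≠ 0)
    (huv : ψ (branchesThrough k u ×ˢ branchesThrough k v) ≠ 0) :
    W k u v ≤ ∫⁻ p, c p.1 p.2
      ∂ProbabilityTheory.cond ψ (branchesThrough k u ×ˢ branchesThrough k v) := by
  have : IsProbabilityMeasure ψ := hψ.1.isProbabilityMeasure
  have hψs : IsFinitelySupported ψ := hα.of_isCoupling hβ hψ.1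
  induction k generalizing u v with
  | zero =>
    have h1 := cond_isProbabilityMeasure huv
    rw [branchesThrough_zero, branchesThrough_zero, Set.singleton_prod_singleton] at huv h1 ⊢
    calc W 0 u v ≤ c u v := h0 u v
      _ = ∫⁻ _, c u v ∂ProbabilityTheory.cond ψ {(u, v)} := by simp
      _ ≤ _ := by
        refine lintegral_mono_ae ?_
        filter_upwards [ae_cond_mem (measurableSet_singleton (u, v))] with p hp
        rw [Set.mem_singleton_iff] at hp
        rw [hp]
  | succ k ih =>
    set R := branchesThrough (k + 1) u ×ˢ branchesThrough (k + 1) v with hR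
    have hRm : MeasurableSet R :=
      (measurableSet_branchesThrough _ _).prod (measurableSet_branchesThrough _ _)
    set θ := ProbabilityTheory.cond ψ R with hθ
    have hθp : IsProbabilityMeasure θ := cond_isProbabilityMeasure huv
    have hθs : IsFinitelySupported θ := hψs.cond R
    let R' : (Fin n → E) × (Fin n → E) → Set ((Fin n → E) × (Fin n → E)) := fun p =>
      branchesThrough k p.1 ×ˢ branchesThrough k p.2
    have hR'm : ∀ p, MeasurableSet (R' p) := fun p =>
      (measurableSet_branchesThrough _ _).prod (measurableSet_branchesThrough _ _)
    calc W (k + 1) u v ≤ ∫⁻ p, W k p.1 p.2 ∂θ :=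
          (hs k hk u v hu hv).trans (iInf₂_le θ (hψ.2 (k + 1) u v huv))
      _ ≤ ∫⁻ p, ∫⁻ q, c q.1 q.2 ∂ProbabilityTheory.cond θ (R' p) ∂θ := by
          refine lintegral_mono_ae ?_
          filter_upwards [hθs.ae_singleton_ne_zero, ae_cond_mem hRm] with p hp hpR
          have hψp : ψ {p} ≠ 0 := fun h => hp (cond_absolutelyContinuous h)
          have hsub : R' p ⊆ R := Set.prod_mono
            ((branchesThrough_mono k.le_succ _).trans (branchesThrough_eq hpR.1).subset)
            ((branchesThrough_mono k.le_succ _).trans (branchesThrough_eq hpR.2).subset)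
          rw [hθ, cond_cond_eq_cond_inter hRm (hR'm p), Set.inter_eq_self_of_subset_right hsub]
          refine ih (Nat.le_of_succ_le hk) (hψ.1.fst_ne_zero hψp) (hψ.1.snd_ne_zero hψp)
            fun h => hψp (measure_mono_null ?_ h)
          rw [Set.singleton_subset_iff]
          exact ⟨self_mem_branchesThrough _ _, self_mem_branchesThrough _ _⟩
      _ = _ := by
          refine hθs.lintegral_lintegral_cond hR'm
            (fun p => ⟨self_mem_branchesThrough _ _, self_mem_branchesThrough _ _⟩) ?_ _
          intro p q hq
          simp only [R', branchesThrough_eq hq.1, branchesThrough_eq hq.2]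

/-- The conditional measures of `ψ` on pairs of vertices of level at most `k` are couplings of the
conditional measures of `α` and `β`. -/
def IsMarkovUpTo (k : ℕ) (α β : Measure (Fin n → E)) (ψ : Measure ((Fin n → E) × (Fin n → E))) :
    Prop :=
  ∀ j ≤ k, ∀ a b : Fin n → E, ∀ A : Set (Fin n → E), MeasurableSet A →
    ψ ((A ∩ branchesThrough j a) ×ˢ branchesThrough j b) =
        ψ (branchesThrough j a ×ˢ branchesThrough j b) *
          ProbabilityTheory.cond α (branchesThrough j a) A ∧
      ψ (branchesThrough j a ×ˢ (A ∩ branchesThrough j b)) =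
        ψ (branchesThrough j a ×ˢ branchesThrough j b) *
          ProbabilityTheory.cond β (branchesThrough j b) A

theorem lintegral_cond_cond_branchesThrough (hα : IsFinitelySupported α) {j k : ℕ} (hjk : j ≤ k)
    {u : Fin n → E} {A : Set (Fin n → E)} (hA : MeasurableSet A) :
    ∫⁻ a, ProbabilityTheory.cond α (branchesThrough j a) A
      ∂ProbabilityTheory.cond α (branchesThrough k u) =
        ProbabilityTheory.cond α (branchesThrough k u) A := by
  have h := (hα.cond (branchesThrough k u)).lintegral_lintegral_cond
    (measurableSet_branchesThrough j) (self_mem_branchesThrough j)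
    (fun _ _ => branchesThrough_eq) (A.indicator 1)
  simp_rw [lintegral_indicator_one hA] at h
  rw [← h]
  refine lintegral_congr_ae ?_
  filter_upwards [ae_cond_mem (measurableSet_branchesThrough k u)] with a ha
  rw [cond_cond_branchesThrough hjk ha]

omit [IsProbabilityMeasure α] in
theorem cond_branchesThrough_eq_zero {k : ℕ} {a u : Fin n → E} (h : a ∉ branchesThrough k u) :
    ProbabilityTheory.cond α (branchesThrough k u) (branchesThrough k a) = 0 := by
  rw [cond_apply (measurableSet_branchesThrough _ _), (disjoint_branchesThrough h).symm.inter_eq]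
  simp

-- At level `k + 1` the measure `ψ` sits on the single pair of vertices through `u` and `v`. On that
-- pair the identities say that `ψ` is a coupling; on every other pair both sides vanish.
omit [IsProbabilityMeasure β] in
theorem IsMarkovUpTo.succ {k : ℕ} {u v : Fin n → E} {ψ : Measure ((Fin n → E) × (Fin n → E))}
    (hu : α {u} ≠ 0) (h : IsMarkovUpTo k α β ψ)
    (hψ : IsCoupling (ProbabilityTheory.cond α (branchesThrough (k + 1) u))
      (ProbabilityTheory.cond β (branchesThrough (k + 1) v)) ψ) :
    IsMarkovUpTo (k + 1) α β ψ := by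
  intro j hj a b A hA
  rcases Nat.of_le_succ hj with hj | rfl
  · exact h j hj a b A hA
  by_cases hab : a ∈ branchesThrough (k + 1) u ∧ b ∈ branchesThrough (k + 1) v
  · have hpu : IsProbabilityMeasure (ProbabilityTheory.cond α (branchesThrough (k + 1) u)) :=
      cond_isProbabilityMeasure fun h0 => hu (measure_mono_null
        (Set.singleton_subset_iff.2 (self_mem_branchesThrough _ _)) h0)
    have hp := hψ.isProbabilityMeasure
    rw [branchesThrough_eq hab.1, branchesThrough_eq hab.2]
    have h1 := hψ.ae_fst (ae_cond_mem (measurableSet_branchesThrough (k + 1) u))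
    have h2 := hψ.ae_snd (ae_cond_mem (measurableSet_branchesThrough (k + 1) v))
    have e0 : ψ (branchesThrough (k + 1) u ×ˢ branchesThrough (k + 1) v) = 1 := by
      rw [← measure_univ (μ := ψ)]
      refine measure_congr ?_
      filter_upwards [h1, h2] with p hp1 hp2
      exact propext ⟨fun _ => trivial, fun _ => ⟨hp1, hp2⟩⟩
    rw [e0, one_mul, one_mul]
    constructor
    · conv_rhs => rw [← hψ.1, Measure.map_apply measurable_fst hA]
      refine measure_congr ?_
      filter_upwards [h1, h2] with p hp1 hp2
      exact propext ⟨fun h => h.1.1, fun h => ⟨⟨h, hp1⟩, hp2⟩⟩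
    · conv_rhs => rw [← hψ.2, Measure.map_apply measurable_snd hA]
      refine measure_congr ?_
      filter_upwards [h1, h2] with p hp1 hp2
      exact propext ⟨fun h => h.2.1, fun h => ⟨hp1, h, hp2⟩⟩
  · have e0 : ψ (branchesThrough (k + 1) a ×ˢ branchesThrough (k + 1) b) = 0 := by
      rcases not_and_or.1 hab with ha | hb
      · have := cond_branchesThrough_eq_zero (α := α) ha
        rw [← hψ.1, Measure.map_apply measurable_fst (measurableSet_branchesThrough _ _)] at this
        exact measure_mono_null (fun p hp => hp.1) this
      · have := cond_branchesThrough_eq_zero (α := β) hb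
        rw [← hψ.2, Measure.map_apply measurable_snd (measurableSet_branchesThrough _ _)] at this
        exact measure_mono_null (fun p hp => hp.2) this
    rw [e0, zero_mul, zero_mul]
    exact ⟨measure_mono_null (Set.prod_mono Set.inter_subset_right le_rfl) e0,
      measure_mono_null (Set.prod_mono le_rfl Set.inter_subset_right) e0⟩

/-- A nearly optimal coupling `θ` for the cost `W k` is refined by replacing each of its atoms `p`
by a nearly optimal coupling of the two subtrees through `p`, given by induction. Each level loses
at most `ε`. -/
theorem exists_isMarkovUpTo (hα : IsFinitelySupported α) (hβ : IsFinitelySupported β)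
    (h0 : ∀ u v, c u v ≤ W 0 u v)
    (hs : ∀ k < n, ∀ u v, α {u} ≠ 0 → β {v} ≠ 0 →
      kantorovich (W k) (ProbabilityTheory.cond α (branchesThrough (k + 1) u))
        (ProbabilityTheory.cond β (branchesThrough (k + 1) v)) ≤ W (k + 1) u v)
    {ε : ℝ≥0∞} (hε : ε ≠ 0) {k : ℕ} (hk : k ≤ n)
    {u v : Fin n → E} (hu : α {u} ≠ 0) (hv : β {v} ≠ 0) :
    ∃ ψ, IsCoupling (ProbabilityTheory.cond α (branchesThrough k u))
        (ProbabilityTheory.cond β (branchesThrough k v)) ψ ∧ IsMarkovUpTo k α β ψ ∧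
      ∫⁻ p, c p.1 p.2 ∂ψ ≤ W k u v + k * ε := by
  have hprob : ∀ {γ : Measure (Fin n → E)} [IsProbabilityMeasure γ] {w : Fin n → E} (j : ℕ),
      γ {w} ≠ 0 → IsProbabilityMeasure (ProbabilityTheory.cond γ (branchesThrough j w)) :=
    fun j hw => cond_isProbabilityMeasure fun h0 => hw (measure_mono_null
        (Set.singleton_subset_iff.2 (self_mem_branchesThrough _ _)) h0)
  induction k generalizing u v with
  | zero =>
    -- Vertices of level 0 are single branches, so the product coupling is concentrated at `(u, v)`.
    have hpu := hprob 0 hu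
    have hpv := hprob 0 hv
    have hc : IsCoupling (ProbabilityTheory.cond α (branchesThrough 0 u))
        (ProbabilityTheory.cond β (branchesThrough 0 v))
        ((ProbabilityTheory.cond α (branchesThrough 0 u)).prod
          (ProbabilityTheory.cond β (branchesThrough 0 v))) := isCoupling_prod
    refine ⟨_, hc, ?_, ?_⟩
    · intro j hj a b A hA
      obtain rfl : j = 0 := Nat.le_zero.1 hj
      simp only [Measure.prod_prod]
      have key : ∀ {γ : Measure (Fin n → E)} [IsProbabilityMeasure γ] (w a : Fin n → E),
          ProbabilityTheory.cond γ (branchesThrough 0 w) (A ∩ branchesThrough 0 a) =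
          ProbabilityTheory.cond γ (branchesThrough 0 w) (branchesThrough 0 a) *
            ProbabilityTheory.cond γ (branchesThrough 0 a) A := by
        intro γ _ w a
        have hm := measurableSet_branchesThrough 0 a
        rw [Set.inter_comm, ← cond_mul_eq_inter hm, mul_comm]
        by_cases ha : a ∈ branchesThrough 0 w
        · rw [cond_cond_branchesThrough le_rfl ha]
        · rw [cond_branchesThrough_eq_zero ha, zero_mul, zero_mul]
      rw [key, key]
      exact ⟨by ring, by ring⟩
    · have h1 := hc.ae_fst (ae_cond_mem (measurableSet_branchesThrough 0 u))
      have h2 := hc.ae_snd (ae_cond_mem (measurableSet_branchesThrough 0 v))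
      calc _ ≤ ∫⁻ _, W 0 u v ∂((ProbabilityTheory.cond α (branchesThrough 0 u)).prod
          (ProbabilityTheory.cond β (branchesThrough 0 v))) := by
            refine lintegral_mono_ae ?_
            filter_upwards [h1, h2] with p hp1 hp2
            rw [branchesThrough_zero, Set.mem_singleton_iff] at hp1 hp2
            rw [hp1, hp2]
            exact h0 u v
        _ ≤ _ := by simp
  | succ k ih =>
    have hpu := hprob (k + 1) hu
    have hpv := hprob (k + 1) hv
    set α' := ProbabilityTheory.cond α (branchesThrough (k + 1) u) with hα'
    set β' := ProbabilityTheory.cond β (branchesThrough (k + 1) v) with hβ'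
    obtain ⟨θ, hθ, hθle⟩ := exists_isCoupling_le (α := α') (β := β') (W k) hε
    have hθp := hθ.isProbabilityMeasure
    have hθs : IsFinitelySupported θ := (hα.cond _).of_isCoupling (hβ.cond _) hθ
    obtain ⟨S, hS⟩ := id hθs
    have hex : ∀ p : (Fin n → E) × (Fin n → E), ∃ ψ, θ {p} ≠ 0 →
        IsCoupling (ProbabilityTheory.cond α (branchesThrough k p.1))
          (ProbabilityTheory.cond β (branchesThrough k p.2)) ψ ∧ IsMarkovUpTo k α β ψ ∧
        ∫⁻ p, c p.1 p.2 ∂ψ ≤ W k p.1 p.2 + k * ε := by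
      intro p
      by_cases hp : θ {p} = 0
      · exact ⟨0, fun h => absurd hp h⟩
      · have h1 : α {p.1} ≠ 0 := fun h => hθ.fst_ne_zero hp (cond_absolutelyContinuous h)
        have h2 : β {p.2} ≠ 0 := fun h => hθ.snd_ne_zero hp (cond_absolutelyContinuous h)
        obtain ⟨ψ, hψ⟩ := ih (Nat.le_of_succ_le hk) h1 h2
        exact ⟨ψ, fun _ => hψ⟩
    choose Ψ hΨ using hex
    set ψ : Measure ((Fin n → E) × (Fin n → E)) := ∑ p ∈ S, θ {p} • Ψ p with hψdef
    have hψapply : ∀ T, ψ T = ∑ p ∈ S, θ {p} * Ψ p T := fun T => by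
      simp [hψdef, Measure.finsetSum_apply]
    have hcoup : IsCoupling α' β' ψ := by
      constructor
      · ext A hA
        rw [Measure.map_apply measurable_fst hA, hψapply, hα',
          ← lintegral_cond_cond_branchesThrough hα k.le_succ hA, ← hα', ← hθ.1,
          lintegral_map' (IsFinitelySupported.aemeasurable (by rw [hθ.1]; exact hα.cond _) _)
            measurable_fst.aemeasurable, lintegral_eq_sum_of_support hS]
        refine Finset.sum_congr rfl fun p _ => ?_
        by_cases hp : θ {p} = 0
        · simp [hp]
        · rw [← (hΨ p hp).1.1, Measure.map_apply measurable_fst hA, mul_comm]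
      · ext A hA
        rw [Measure.map_apply measurable_snd hA, hψapply, hβ',
          ← lintegral_cond_cond_branchesThrough hβ k.le_succ hA, ← hβ', ← hθ.2,
          lintegral_map' (IsFinitelySupported.aemeasurable (by rw [hθ.2]; exact hβ.cond _) _)
            measurable_snd.aemeasurable, lintegral_eq_sum_of_support hS]
        refine Finset.sum_congr rfl fun p _ => ?_
        by_cases hp : θ {p} = 0
        · simp [hp]
        · rw [← (hΨ p hp).1.2, Measure.map_apply measurable_snd hA, mul_comm]
    -- The identities defining `IsMarkovUpTo` are linear in the coupling, unlike those with
    -- conditional measures of `ψ`, so they pass to mixtures.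
    have hmark : IsMarkovUpTo k α β ψ := by
      intro j hj a b A hA
      simp only [hψapply, Finset.sum_mul]
      constructor
      · refine Finset.sum_congr rfl fun p _ => ?_
        by_cases hp : θ {p} = 0
        · simp [hp]
        · rw [((hΨ p hp).2.1 j hj a b A hA).1, mul_assoc]
      · refine Finset.sum_congr rfl fun p _ => ?_
        by_cases hp : θ {p} = 0
        · simp [hp]
        · rw [((hΨ p hp).2.1 j hj a b A hA).2, mul_assoc]
    refine ⟨ψ, hcoup, hmark.succ hu hcoup, ?_⟩
    calc ∫⁻ p, c p.1 p.2 ∂ψ = ∑ p ∈ S, θ {p} * ∫⁻ q, c q.1 q.2 ∂Ψ p := by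
          rw [hψdef, lintegral_finsetSum_measure]
          simp_rw [lintegral_smul_measure, smul_eq_mul]
      _ ≤ ∑ p ∈ S, (W k p.1 p.2 + k * ε) * θ {p} := by
          refine Finset.sum_le_sum fun p _ => ?_
          by_cases hp : θ {p} = 0
          · simp [hp]
          · rw [mul_comm]
            exact mul_le_mul_left (hΨ p hp).2.2 _
      _ = ∫⁻ p, W k p.1 p.2 ∂θ + k * ε := by
          rw [← lintegral_eq_sum_of_support hS (fun p => W k p.1 p.2 + k * ε),
            lintegral_add_right _ measurable_const]
          simp
      _ ≤ kantorovich (W k) α' β' + ε + k * ε := by gcongr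
      _ ≤ W (k + 1) u v + ε + k * ε := by
          gcongr
          exact hs k hk u v hu hv
      _ = _ := by push_cast; ring

omit [IsProbabilityMeasure β] in
theorem IsMarkovUpTo.isMarkovCoupling {ψ : Measure ((Fin n → E) × (Fin n → E))}
    (h : IsMarkovUpTo n α β ψ) (hψ : IsCoupling α β ψ) : IsMarkovCoupling α β ψ := by
  have hp := hψ.isProbabilityMeasure
  refine ⟨hψ, fun k a b hk => ?_⟩
  -- All levels from `n` on give the root, so only levels up to `n` need checking.
  have hmin : ∀ w : Fin n → E, branchesThrough k w = branchesThrough (min k n) w := by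
    intro w
    rcases le_total k n with hkn | hkn
    · rw [min_eq_left hkn]
    · rw [min_eq_right hkn, branchesThrough_of_le hkn, branchesThrough_of_le le_rfl]
  simp only [hmin] at hk ⊢
  have hm := (measurableSet_branchesThrough (min k n) a).prod
    (measurableSet_branchesThrough (min k n) b)
  constructor
  · ext A hA
    rw [Measure.map_apply measurable_fst hA, cond_apply hm]
    have := (h _ (min_le_right k n) a b A hA).1
    rw [show (branchesThrough (min k n) a ×ˢ branchesThrough (min k n) b) ∩ Prod.fst ⁻¹' A =
      (A ∩ branchesThrough (min k n) a) ×ˢ branchesThrough (min k n) b by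
        ext p; simp only [Set.mem_inter_iff, Set.mem_prod, Set.mem_preimage]; tauto, this,
      ← mul_assoc, ENNReal.inv_mul_cancel hk (measure_ne_top _ _), one_mul]
  · ext A hA
    rw [Measure.map_apply measurable_snd hA, cond_apply hm]
    have := (h _ (min_le_right k n) a b A hA).2
    rw [show (branchesThrough (min k n) a ×ˢ branchesThrough (min k n) b) ∩ Prod.snd ⁻¹' A =
      branchesThrough (min k n) a ×ˢ (A ∩ branchesThrough (min k n) b) by
        ext p; simp only [Set.mem_inter_iff, Set.mem_prod, Set.mem_preimage]; tauto, this,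
      ← mul_assoc, ENNReal.inv_mul_cancel hk (measure_ne_top _ _), one_mul]

/-- The least cost of a Markov coupling is the iterated Kantorovich distance. -/
theorem iInf_isMarkovCoupling_eq (hα : IsFinitelySupported α) (hβ : IsFinitelySupported β)
    (h0 : ∀ u v, W 0 u v = c u v)
    (hs : ∀ k < n, ∀ u v, α {u} ≠ 0 → β {v} ≠ 0 →
      W (k + 1) u v = kantorovich (W k) (ProbabilityTheory.cond α (branchesThrough (k + 1) u))
        (ProbabilityTheory.cond β (branchesThrough (k + 1) v)))
    {u v : Fin n → E} (hu : α {u} ≠ 0) (hv : β {v} ≠ 0) :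
    ⨅ (ψ : Measure ((Fin n → E) × (Fin n → E))) (_ : IsMarkovCoupling α β ψ),
      ∫⁻ p, c p.1 p.2 ∂ψ = W n u v := by
  have huniv : ∀ w : Fin n → E, branchesThrough n w = Set.univ := branchesThrough_of_le le_rfl
  refine le_antisymm ?_ (le_iInf₂ fun ψ hψ => ?_)
  · refine ENNReal.le_of_forall_pos_le_add fun ε hε _ => ?_
    -- The error is shared among `n` levels. For `n = 0` the quotient is infinite, but it is then
    -- multiplied by zero.
    have hδ : (ε : ℝ≥0∞) / n ≠ 0 :=
      (ENNReal.div_pos (by exact_mod_cast hε.ne') (ENNReal.natCast_ne_top n)).ne'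
    obtain ⟨ψ, h1, h2, h3⟩ := exists_isMarkovUpTo hα hβ (fun u v => (h0 u v).ge)
      (fun k hk u v hu hv => (hs k hk u v hu hv).ge) hδ le_rfl hu hv
    rw [huniv, huniv, cond_univ, cond_univ] at h1
    exact iInf₂_le_of_le ψ (h2.isMarkovCoupling h1)
      (h3.trans (add_le_add le_rfl ENNReal.mul_div_le))
  · have hp := hψ.1.isProbabilityMeasure
    have h := le_lintegral_of_isMarkovCoupling hα hβ (fun u v => (h0 u v).le)
      (fun k hk u v hu hv => (hs k hk u v hu hv).le) hψ le_rfl hu hv (by simp [huniv])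
    rwa [huniv, huniv, Set.univ_prod_univ, cond_univ] at h

end DynamicProgramming

/-! ### Conditional measures as families of measures -/

section ConditionalMeasures

/-- A countable generating algebra reduces the exceptional sets, one for each `A`, to a single null
set. -/
theorem ae_measure_eq {Ω X : Type*} [MeasurableSpace Ω] [MeasurableSpace X]
    [MeasurableSpace.CountablyGenerated X] {μ : Measure Ω} {κ η : Ω → Measure X}
    [∀ ω, IsProbabilityMeasure (κ ω)] [∀ ω, IsProbabilityMeasure (η ω)]
    (h : ∀ A, MeasurableSet A → ∀ᵐ ω ∂μ, κ ω A = η ω A) : ∀ᵐ ω ∂μ, κ ω = η ω := by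
  set 𝒞 := generateSetAlgebra (MeasurableSpace.countableGeneratingSet X) with h𝒞
  have hgen : (inferInstance : MeasurableSpace X) = MeasurableSpace.generateFrom 𝒞 := by
    rw [h𝒞, generateFrom_generateSetAlgebra_eq,
      MeasurableSpace.generateFrom_countableGeneratingSet]
  have hcount : 𝒞.Countable :=
    countable_generateSetAlgebra (MeasurableSpace.countable_countableGeneratingSet)
  have hpi : IsPiSystem 𝒞 := fun s hs t ht _ =>
    isSetAlgebra_generateSetAlgebra.inter_mem hs ht
  have hall : ∀ᵐ ω ∂μ, ∀ A ∈ 𝒞, κ ω A = η ω A :=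
    (ae_ball_iff hcount).2 fun A hA => h A (by
      have := MeasurableSpace.measurableSet_generateFrom hA
      rwa [← hgen] at this)
  filter_upwards [hall] with ω hω
  exact ext_of_generate_finite 𝒞 hgen hpi hω (by simp)

variable {X : Type*} {m m' : MeasurableSpace X} [mX : MeasurableSpace X] [StandardBorelSpace X]
  {μ : Measure X} [IsProbabilityMeasure μ]

/-- The tower property of conditional expectation, for measures instead of single events. -/
theorem condExpKernel_bind_of_le (hmm' : m ≤ m') (hm' : m' ≤ mX) :
    ∀ᵐ x ∂μ, condExpKernel μ m x =
      (condExpKernel μ m x).bind (fun y => condExpKernel μ m' y) := by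
  have hmeas := measurable_condExpKernel_of_le (μ := μ) hm'
  have hp : ∀ x, IsProbabilityMeasure
      ((condExpKernel μ m x).bind (fun y => condExpKernel μ m' y)) := fun x =>
    isProbabilityMeasure_bind hmeas.aemeasurable (ae_of_all _ fun y => inferInstance)
  have hp' : ∀ x, IsProbabilityMeasure (condExpKernel μ m x) := fun x => inferInstance
  refine ae_measure_eq fun A hA => ?_
  have h1 := condExpKernel_ae_eq_condExp (μ := μ) (hmm'.trans hm') hA
  have hint : Integrable (fun y => (condExpKernel μ m' y).real A) μ :=
    integrable_toReal_condExpKernel hA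
  have h2 := condExp_ae_eq_integral_condExpKernel (μ := μ) (hmm'.trans hm') hint
  have h3 := condExp_congr_ae (m := m) (condExpKernel_ae_eq_condExp (μ := μ) hm' hA)
  have h4 : μ[μ⟦A|m'⟧|m] =ᵐ[μ] μ⟦A|m⟧ := condExp_condExp_of_le hmm' hm'
  filter_upwards [h1, h2, h3, h4] with x hx1 hx2 hx3 hx4
  rw [← measureReal_eq_measureReal_iff, hx1, ← hx4, ← hx3, hx2, measureReal_def,
    Measure.bind_apply hA hmeas.aemeasurable]
  exact integral_toReal ((Measure.measurable_coe hA).comp hmeas).aemeasurable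
    (ae_of_all _ fun y => measure_lt_top _ _)

/-- Events in terms of `τ` have conditional probability 0 or 1, so the image of the conditional
measure under `τ` is a Dirac measure. -/
theorem ae_condExpKernel_comap_eq {Y : Type*} [mY : MeasurableSpace Y]
    [MeasurableSpace.CountablyGenerated Y] [MeasurableSingletonClass Y] {τ : X → Y}
    (hτ : Measurable τ) :
    ∀ᵐ x ∂μ, ∀ᵐ y ∂condExpKernel μ (mY.comap τ) x, τ y = τ x := by
  have hp : ∀ x, IsProbabilityMeasure ((condExpKernel μ (mY.comap τ) x).map τ) := fun x =>
    Measure.isProbabilityMeasure_map hτ.aemeasurable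
  have h : ∀ᵐ x ∂μ, (condExpKernel μ (mY.comap τ) x).map τ = Measure.dirac (τ x) := by
    refine ae_measure_eq fun B hB => ?_
    have hB' : MeasurableSet[mY.comap τ] (τ ⁻¹' B) := ⟨B, hB, rfl⟩
    filter_upwards [ae_condExpKernel_mem hτ.comap_le hB',
      ae_condExpKernel_mem hτ.comap_le hB'.compl] with x h1 h2
    rw [Measure.map_apply hτ hB, Measure.dirac_apply' _ hB]
    by_cases hx : τ x ∈ B
    · rw [Set.indicator_of_mem hx, Pi.one_apply]
      exact (prob_compl_eq_zero_iff (hτ hB)).1 (mem_ae_iff.1 (h1 hx))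
    · rw [Set.indicator_of_notMem hx]
      have := mem_ae_iff.1 (h2 hx)
      rwa [Set.ofPred_mem_eq, compl_compl] at this
  filter_upwards [h] with x hx
  have : ∀ᵐ y ∂(condExpKernel μ (mY.comap τ) x).map τ, y = τ x := by
    rw [hx]
    exact (ae_dirac_iff (p := fun y => y = τ x) (measurableSet_singleton (τ x))).2 rfl
  exact ae_of_ae_map hτ.aemeasurable this

/-- The chosen kernel is measurable for the smaller σ-algebra, hence exactly constant on the fibers
of `τ`, with no exceptional set. -/
theorem condExpKernel_comap_congr {Y : Type*} [mY : MeasurableSpace Y] {τ : X → Y} {x y : X}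
    (h : τ x = τ y) : condExpKernel μ (mY.comap τ) x = condExpKernel μ (mY.comap τ) y := by
  ext A hA
  exact (measurable_condExpKernel (m := mY.comap τ) (μ := μ) hA).factorsThrough h

end ConditionalMeasures

/-! ### Conditional measures of a Markov chain -/

section Chain

variable {E : Type*}

/-- The variables `fₙ, f_{n+1}, …`. -/
def tailSequence (E : Type*) (n : ℕ) (x : ℕ → E) : ℕ → E := fun k => x (n + k)

/-- The trajectory with initial segment `u` that continues as `x`. -/
def glue {n : ℕ} (u : Fin n → E) (x : ℕ → E) : ℕ → E :=
  fun i => if h : i < n then u ⟨i, h⟩ else x i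

theorem initialSegment_glue {n : ℕ} (u : Fin n → E) (x : ℕ → E) :
    initialSegment E n (glue u x) = u := by
  ext i
  simp [initialSegment, glue]

theorem tailSequence_glue {n : ℕ} (u : Fin n → E) (x : ℕ → E) :
    tailSequence E n (glue u x) = tailSequence E n x := by
  ext i
  simp [tailSequence, glue]

theorem glue_initialSegment {n : ℕ} {x y : ℕ → E} (h : tailSequence E n y = tailSequence E n x) :
    glue (initialSegment E n y) x = y := by
  ext i
  by_cases hi : i < n
  · simp [glue, hi, initialSegment]
  · have := congrFun h (i - n)
    simp only [tailSequence, Nat.add_sub_cancel' (not_lt.1 hi)] at this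
    simp [glue, hi, this]

theorem tailSequence_glue_eq_iff {n k : ℕ} (u v : Fin n → E) (x : ℕ → E) :
    tailSequence E k (glue v x) = tailSequence E k (glue u x) ↔ v ∈ branchesThrough k u := by
  constructor
  · intro h i hi
    have := congrFun h (i - k)
    simpa [tailSequence, Nat.add_sub_cancel' hi, glue] using this
  · intro h
    ext i
    by_cases hi : k + i < n
    · simpa [tailSequence, glue, hi] using h ⟨k + i, hi⟩ (Nat.le_add_right k i)
    · simp [tailSequence, glue, hi]

variable [MeasurableSpace E]

theorem measurable_tailSequence (n : ℕ) : Measurable (tailSequence E n) :=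
  measurable_pi_lambda _ fun _ => measurable_pi_apply _

theorem measurable_initialSegment (n : ℕ) : Measurable (initialSegment E n) :=
  measurable_pi_lambda _ fun _ => measurable_pi_apply _

theorem measurable_glue {n : ℕ} (x : ℕ → E) : Measurable fun u : Fin n → E => glue u x := by
  refine measurable_pi_lambda _ fun i => ?_
  by_cases h : i < n
  · simp only [glue, h, dite_true]
    exact measurable_pi_apply _
  · simp only [glue, h, dite_false]
    exact measurable_const

theorem tailAlgebra_antitone {k n : ℕ} (h : k ≤ n) : tailAlgebra E n ≤ tailAlgebra E k := by
  rintro _ ⟨B, hB, rfl⟩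
  refine ⟨(fun y i => y (n - k + i)) ⁻¹' B,
    measurable_pi_lambda _ (fun _ => measurable_pi_apply _) hB, ?_⟩
  ext x
  simp [← add_assoc, Nat.add_sub_cancel' h]

variable [StandardBorelSpace E] {μ : Measure (ℕ → E)} [IsProbabilityMeasure μ]

theorem condExpKernel_tailAlgebra_congr {n : ℕ} {x y : ℕ → E}
    (h : tailSequence E n x = tailSequence E n y) :
    condExpKernel μ (tailAlgebra E n) x = condExpKernel μ (tailAlgebra E n) y :=
  condExpKernel_comap_congr h

theorem ae_tailSequence_eq (n : ℕ) : ∀ᵐ x ∂μ, ∀ᵐ y ∂condExpKernel μ (tailAlgebra E n) x,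
    tailSequence E n y = tailSequence E n x :=
  ae_condExpKernel_comap_eq (measurable_tailSequence n)

/-- Given `fₙ`, the future does not change the conditional distribution of the past. -/
theorem IsMarkovChain.condExp_tailAlgebra (hM : IsMarkovChain μ) (n : ℕ) {t : Set (ℕ → E)}
    (ht : MeasurableSet[pastAlgebra E (n + 1)] t) :
    μ⟦t|presentAlgebra E n⟧ =ᵐ[μ] μ⟦t|tailAlgebra E n⟧ := by
  have hpres : presentAlgebra E n ≤ tailAlgebra E n := by
    rintro _ ⟨B, hB, rfl⟩
    exact ⟨(fun y => y 0) ⁻¹' B, measurable_pi_apply 0 hB, rfl⟩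
  have hpast : pastAlgebra E (n + 1) ≤ (inferInstance : MeasurableSpace (ℕ → E)) :=
    (measurable_initialSegment (n + 1)).comap_le
  have hind := (condIndep_iff _ _ _ (presentAlgebra_le n) hpast (tailAlgebra_le n) μ).1 (hM n)
  have htm : MeasurableSet t := hpast _ ht
  refine ae_eq_condExp_of_forall_setIntegral_eq (tailAlgebra_le n)
    ((integrable_const _).indicator htm) (fun s _ _ => integrable_condExp.integrableOn) ?_
    (stronglyMeasurable_condExp.mono hpres).aestronglyMeasurable
  intro s hs _
  have hsm : MeasurableSet s := tailAlgebra_le n _ hs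
  set g := μ⟦t|presentAlgebra E n⟧ with hg
  set e : (ℕ → E) → ℝ := s.indicator fun _ => 1 with he
  have hmul : s.indicator g = g * e := by
    ext x
    by_cases hx : x ∈ s <;> simp [he, hx]
  have hgs : Integrable (g * e) μ := by
    rw [← hmul]
    exact integrable_condExp.indicator hsm
  calc ∫ x in s, g x ∂μ = ∫ x, (g * e) x ∂μ := by
        rw [← integral_indicator hsm, hmul]
    _ = ∫ x, (μ[g * e|presentAlgebra E n]) x ∂μ :=
        (integral_condExp (presentAlgebra_le n)).symm
    _ = ∫ x, (g * μ⟦s|presentAlgebra E n⟧) x ∂μ := by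
        refine integral_congr_ae ?_
        exact condExp_mul_of_stronglyMeasurable_left stronglyMeasurable_condExp hgs
          ((integrable_const _).indicator hsm)
    _ = ∫ x, (μ⟦t ∩ s|presentAlgebra E n⟧) x ∂μ := integral_congr_ae (hind t s ht hs).symm
    _ = ∫ x, (t ∩ s).indicator (fun _ => (1 : ℝ)) x ∂μ := integral_condExp (presentAlgebra_le n)
    _ = ∫ x in s, t.indicator (fun _ => (1 : ℝ)) x ∂μ := by
        rw [← integral_indicator hsm, Set.indicator_indicator, Set.inter_comm]

variable [Nonempty E]

instance (n : ℕ) (s : E) : IsProbabilityMeasure (condInitial μ n s) := by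
  unfold condInitial
  infer_instance

/-- Given the future from time `n` on, the initial segment has the conditional distribution
given `fₙ`. -/
theorem IsMarkovChain.map_initialSegment (hM : IsMarkovChain μ) (n : ℕ) :
    ∀ᵐ x ∂μ, (condExpKernel μ (tailAlgebra E n) x).map (initialSegment E n) =
      condInitial μ n (x n) := by
  have hp : ∀ x, IsProbabilityMeasure
      ((condExpKernel μ (tailAlgebra E n) x).map (initialSegment E n)) := fun x =>
    Measure.isProbabilityMeasure_map (measurable_initialSegment n).aemeasurable
  refine ae_measure_eq fun U hU => ?_
  have hUm : MeasurableSet (initialSegment E n ⁻¹' U) := measurable_initialSegment n hU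
  have hpast : MeasurableSet[pastAlgebra E (n + 1)] (initialSegment E n ⁻¹' U) :=
    ⟨(fun u : Fin (n + 1) → E => fun i : Fin n => u i.castSucc) ⁻¹' U,
      measurable_pi_lambda _ (fun _ => measurable_pi_apply _) hU, rfl⟩
  filter_upwards [condExpKernel_ae_eq_condExp (μ := μ) (tailAlgebra_le n) hUm,
    hM.condExp_tailAlgebra n hpast,
    condDistrib_ae_eq_condExp (μ := μ) (measurable_pi_apply n) (measurable_initialSegment n) hU]
    with x h1 h2 h3
  rw [Measure.map_apply (measurable_initialSegment n) hU, ← measureReal_eq_measureReal_iff, h1,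
    ← h2, ← h3]
  rfl

/-- Given the trajectory from `n + 1` on, `fₙ` takes finitely many values, and each value fixes the
tail from `n` on, hence the conditional measure, which is finitely supported by induction. -/
theorem IsMarkovChain.isFinitelySupported_condExpKernel (hM : IsMarkovChain μ)
    (hF : HasFiniteTransitions μ) (n : ℕ) :
    ∀ᵐ x ∂μ, IsFinitelySupported (condExpKernel μ (tailAlgebra E n) x) := by
  classical
  induction n with
  | zero =>
    filter_upwards [ae_tailSequence_eq (μ := μ) 0] with x hx
    refine ⟨{x}, ?_⟩
    refine measure_mono_null (fun y hy => ?_) (ae_iff.1 hx)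
    refine fun h => hy ?_
    have : y = x := by
      ext i
      simpa [tailSequence] using congrFun h i
    simp [this]
  | succ n ih =>
    have hcomp := ae_of_ae_map (f := fun x : ℕ → E => x (n + 1))
      (measurable_pi_apply (n + 1)).aemeasurable
      (condDistrib_comp (μ := μ) (fun x : ℕ → E => x (n + 1))
        (measurable_initialSegment (n + 1)).aemeasurable (f := fun u => u (Fin.last n))
        (measurable_pi_apply _))
    filter_upwards [ae_ae_condExpKernel (tailAlgebra_le (n + 1)) ih,
      condExpKernel_bind_of_le (μ := μ) (tailAlgebra_antitone (E := E) n.le_succ)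
        (tailAlgebra_le n),
      ae_ae_condExpKernel (tailAlgebra_le (n + 1)) (ae_tailSequence_eq (μ := μ) n),
      ae_tailSequence_eq (μ := μ) (n + 1), hM.map_initialSegment (n + 1), hF n, hcomp]
      with x h1 h2 h3 h4 h5 h6 h7
    set Q := condExpKernel μ (tailAlgebra E (n + 1)) x with hQ
    obtain ⟨S, hS⟩ := h6
    have h8 : ∀ᵐ y ∂Q, y n ∈ (S : Set E) := by
      have e : (fun u : Fin (n + 1) → E => u (Fin.last n)) ∘ initialSegment E (n + 1) =
        fun z => z n := rfl
      rw [e] at h7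
      rw [h7, Kernel.map_apply _ (measurable_pi_apply _)] at hS
      have h9 : ((condInitial μ (n + 1) (x (n + 1))).map fun u => u (Fin.last n)) (S : Set E)ᶜ = 0 :=
        hS
      rw [← h5, Measure.map_map (measurable_pi_apply _) (measurable_initialSegment _), e,
        Measure.map_apply (measurable_pi_apply n) S.measurableSet.compl] at h9
      exact mem_ae_iff.2 h9
    let P : E → (ℕ → E) → Prop := fun v y =>
      IsFinitelySupported (condExpKernel μ (tailAlgebra E n) y) ∧ y n = v ∧
        tailSequence E (n + 1) y = tailSequence E (n + 1) x
    -- All points satisfying `P v` have the same tail from `n` on, so the same conditional measure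
    -- and one common finite support.
    have hex : ∀ v, ∃ T : Finset (ℕ → E), ∀ y, P v y →
        condExpKernel μ (tailAlgebra E n) y (T : Set (ℕ → E))ᶜ = 0 := by
      intro v
      by_cases hv : ∃ y, P v y
      · obtain ⟨y, ⟨T, hT⟩, hyn, hyt⟩ := hv
        refine ⟨T, fun z hz => ?_⟩
        rw [condExpKernel_tailAlgebra_congr (y := y), hT]
        ext i
        rcases i with _ | i
        · exact hz.2.1.trans hyn.symm
        · have := congrFun (hz.2.2.trans hyt.symm) i
          simpa [tailSequence, add_assoc, add_comm 1 i] using this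
      · exact ⟨∅, fun y hy => absurd ⟨y, hy⟩ hv⟩
    choose T hT using hex
    refine ⟨S.biUnion T, ?_⟩
    rw [h2, Measure.bind_apply (Finset.measurableSet _).compl
      (measurable_condExpKernel_of_le (tailAlgebra_le n)).aemeasurable]
    refine (lintegral_congr_ae ?_).trans lintegral_zero
    filter_upwards [h1, h4, h8] with y hy1 hy4 hy8
    refine measure_mono_null ?_ (hT (y n) y ⟨hy1, rfl, hy4⟩)
    refine Set.compl_subset_compl.2 ?_
    exact_mod_cast Finset.subset_biUnion_of_mem T hy8

/-- For almost every `x`, the measures `μ^y` of the points `y` over which the trajectories end as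
`x` are the conditional measures of the law of the initial segment on the vertices of the tree. -/
theorem IsMarkovChain.ae_condExpKernel_glue (hM : IsMarkovChain μ) (hF : HasFiniteTransitions μ)
    (n : ℕ) : ∀ᵐ x ∂μ, IsFinitelySupported (condInitial μ n (x n)) ∧
      ∀ k ≤ n, ∀ u, condInitial μ n (x n) {u} ≠ 0 →
        condExpKernel μ (tailAlgebra E k) (glue u x) =
          (ProbabilityTheory.cond (condInitial μ n (x n)) (branchesThrough k u)).map
            fun v => glue v x := by
  classical
  have hk1 : ∀ᵐ x ∂μ, ∀ k ≤ n, condExpKernel μ (tailAlgebra E n) x =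
      (condExpKernel μ (tailAlgebra E n) x).bind
        (fun y => condExpKernel μ (tailAlgebra E k) y) := by
    refine ae_all_iff.2 fun k => ?_
    by_cases hk : k ≤ n
    · filter_upwards [condExpKernel_bind_of_le (μ := μ) (tailAlgebra_antitone (E := E) hk)
        (tailAlgebra_le k)] with x hx _ using hx
    · exact ae_of_all _ fun x h => absurd h hk
  have hk2 : ∀ᵐ x ∂μ, ∀ k, ∀ᵐ y ∂condExpKernel μ (tailAlgebra E n) x,
      ∀ᵐ z ∂condExpKernel μ (tailAlgebra E k) y, tailSequence E k z = tailSequence E k y :=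
    ae_all_iff.2 fun k => ae_ae_condExpKernel (tailAlgebra_le n) (ae_tailSequence_eq (μ := μ) k)
  filter_upwards [hM.isFinitelySupported_condExpKernel hF n, hM.map_initialSegment n,
    ae_tailSequence_eq (μ := μ) n, hk1, hk2] with x h1 h2 h3 h4 h5
  set Q := condExpKernel μ (tailAlgebra E n) x with hQ
  set α := condInitial μ n (x n) with hα
  have hglue : Measurable fun v : Fin n → E => glue v x := measurable_glue x
  -- `Q` lives on trajectories that end as `x`, and these are determined by their initial segments.
  have hQα : Q = α.map fun v => glue v x := by
    rw [← h2, Measure.map_map hglue (measurable_initialSegment n)]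
    conv_lhs => rw [← Measure.map_id (μ := Q)]
    refine Measure.map_congr ?_
    filter_upwards [h3] with y hy
    exact (glue_initialSegment hy).symm
  refine ⟨?_, fun k hk u hu => ?_⟩
  · obtain ⟨S, hS⟩ := h1
    refine ⟨S.image (initialSegment E n), ?_⟩
    rw [← h2, Measure.map_apply (measurable_initialSegment n) (Finset.measurableSet _).compl]
    refine measure_mono_null (Set.compl_subset_compl.2 fun y hyS => ?_) hS
    exact Finset.mem_coe.2 (Finset.mem_image_of_mem _ hyS)
  · set C : Set (ℕ → E) := tailSequence E k ⁻¹' {tailSequence E k (glue u x)} with hC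
    have hCm : MeasurableSet C := measurable_tailSequence k (measurableSet_singleton _)
    have hpre : (fun v => glue v x) ⁻¹' C = branchesThrough k u := by
      ext v
      exact tailSequence_glue_eq_iff u v x
    have hBm := measurableSet_branchesThrough k u
    have hQC : Q C = α (branchesThrough k u) := by
      rw [hQα, Measure.map_apply hglue hCm, hpre]
    have hα0 : α (branchesThrough k u) ≠ 0 := fun h0 => hu (measure_mono_null
      (Set.singleton_subset_iff.2 (self_mem_branchesThrough k u)) h0)
    ext A hA
    -- By the tower property `Q` averages the conditional measures of level `k`. They are constant
    -- on the fiber `C` and give `C` mass zero off it. As `C` has positive `Q`-mass, this determines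
    -- the kernel at the very point `glue u x`, not only almost everywhere.
    have key : Q (A ∩ C) = condExpKernel μ (tailAlgebra E k) (glue u x) A * Q C := by
      conv_lhs => rw [h4 k hk]
      rw [Measure.bind_apply (hA.inter hCm)
        (measurable_condExpKernel_of_le (tailAlgebra_le k)).aemeasurable,
        ← setLIntegral_const, ← lintegral_indicator hCm]
      refine lintegral_congr_ae ?_
      filter_upwards [h5 k] with y hy
      by_cases hyC : y ∈ C
      · rw [Set.indicator_of_mem hyC, ← condExpKernel_tailAlgebra_congr (x := y) hyC]
        refine measure_congr ?_
        filter_upwards [hy] with z hz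
        exact propext ⟨fun h => h.1, fun h => ⟨h, hz.trans hyC⟩⟩
      · rw [Set.indicator_of_notMem hyC]
        refine measure_mono_null (fun z hz => ?_) (mem_ae_iff.1 hy)
        exact fun hz' => hyC (Eq.trans (Eq.symm hz') hz.2)
    have hQA : Q (A ∩ C) = α (branchesThrough k u ∩ (fun v => glue v x) ⁻¹' A) := by
      rw [hQα, Measure.map_apply hglue (hA.inter hCm), Set.preimage_inter, hpre, Set.inter_comm]
    rw [Measure.map_apply hglue hA, cond_apply hBm, ← hQA, key, hQC, mul_comm, mul_assoc,
      ENNReal.mul_inv_cancel hα0 (measure_ne_top _ _), mul_one]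

end Chain

/-! ### The criterion -/

/-- The common left inverse `r` carries couplings of the images back to couplings of the originals.
The cost need not be measurable: both inequalities push a coupling forward and use only
`lintegral_map_le`. Two maps are allowed because the two trajectories continue differently. -/
theorem kantorovich_map_map {Z X : Type*} [MeasurableSpace Z] [MeasurableSpace X] {f g : Z → X}
    {r : X → Z} (hf : Measurable f) (hg : Measurable g) (hr : Measurable r)
    (hrf : ∀ z, r (f z) = z) (hrg : ∀ z, r (g z) = z) (c : X → X → ℝ≥0∞) (α β : Measure Z)
    [MeasurableEq X] :
    kantorovich c (α.map f) (β.map g) = kantorovich (fun u v => c (f u) (g v)) α β := by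
  refine le_antisymm (le_iInf₂ fun ψ hψ => ?_) (le_iInf₂ fun ψ hψ => ?_)
  · have hfg : Measurable (Prod.map f g) := hf.prodMap hg
    refine iInf₂_le_of_le (ψ.map (Prod.map f g)) ⟨?_, ?_⟩
      (lintegral_map_le (fun p => c p.1 p.2) (Prod.map f g))
    · rw [Measure.map_map measurable_fst hfg, ← hψ.1, Measure.map_map hf measurable_fst]
      rfl
    · rw [Measure.map_map measurable_snd hfg, ← hψ.2, Measure.map_map hg measurable_snd]
      rfl
  · have hrr : Measurable (Prod.map r r) := hr.prodMap hr
    have h1 : ∀ᵐ x ∂α.map f, f (r x) = x := by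
      refine (ae_map_iff hf.aemeasurable (measurableSet_eq_fun (hf.comp hr) measurable_id)).2 ?_
      exact ae_of_all _ fun z => congrArg f (hrf z)
    have h2 : ∀ᵐ x ∂β.map g, g (r x) = x := by
      refine (ae_map_iff hg.aemeasurable (measurableSet_eq_fun (hg.comp hr) measurable_id)).2 ?_
      exact ae_of_all _ fun z => congrArg g (hrg z)
    refine iInf₂_le_of_le (ψ.map (Prod.map r r)) ⟨?_, ?_⟩
      ((lintegral_map_le (fun p => c (f p.1) (g p.2)) (Prod.map r r)).trans ?_)
    · rw [Measure.map_map measurable_fst hrr,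
        show Prod.fst ∘ Prod.map r r = r ∘ (Prod.fst : X × X → X) from rfl,
        ← Measure.map_map hr measurable_fst, hψ.1, Measure.map_map hr hf]
      rw [show r ∘ f = id from funext hrf, Measure.map_id]
    · rw [Measure.map_map measurable_snd hrr,
        show Prod.snd ∘ Prod.map r r = r ∘ (Prod.snd : X × X → X) from rfl,
        ← Measure.map_map hr measurable_snd, hψ.2, Measure.map_map hr hg]
      rw [show r ∘ g = id from funext hrg, Measure.map_id]
    · refine lintegral_mono_ae ?_
      filter_upwards [hψ.ae_fst h1, hψ.ae_snd h2] with p hp1 hp2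
      simp only [Prod.map_fst, Prod.map_snd, hp1, hp2, le_refl]

section Criterion

variable {E : Type*} [MeasurableSpace E] [StandardBorelSpace E] [Nonempty E]
  {μ : Measure (ℕ → E)} [IsProbabilityMeasure μ]

/-- The Markov distance is the iterated Kantorovich transfer of the cylinder cost. -/
theorem IsMarkovChain.iteratedCost_eq_markovDistance (hM : IsMarkovChain μ)
    (hF : HasFiniteTransitions μ) (n : ℕ) (d : (Fin n → E) → (Fin n → E) → ℝ) :
    ∃ G : Set (ℕ → E), (∀ᵐ x ∂μ, x ∈ G) ∧ ∀ x ∈ G, ∀ y ∈ G,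
      iteratedCost μ (fun x y => ENNReal.ofReal (d (initialSegment E n x) (initialSegment E n y)))
        n x y = markovDistance μ n d (x n) (y n) := by
  refine ⟨_, hM.ae_condExpKernel_glue hF n, ?_⟩
  rintro x ⟨hαs, hα⟩ y ⟨hβs, hβ⟩
  set c : (ℕ → E) → (ℕ → E) → ℝ≥0∞ :=
    fun x y => ENNReal.ofReal (d (initialSegment E n x) (initialSegment E n y)) with hc
  obtain ⟨u, hu⟩ := hαs.ae_singleton_ne_zero.exists
  obtain ⟨v, hv⟩ := hβs.ae_singleton_ne_zero.exists
  have hdp := iInf_isMarkovCoupling_eq (c := fun u v => ENNReal.ofReal (d u v))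
    (W := fun k u v => iteratedCost μ c k (glue u x) (glue v y)) hαs hβs
    (fun u v => by simp only [iteratedCost, hc, initialSegment_glue]) (fun k hk u v hu hv => by
      simp only [iteratedCost, transfer, hα (k + 1) hk u hu, hβ (k + 1) hk v hv]
      exact kantorovich_map_map (measurable_glue x) (measurable_glue y)
        (measurable_initialSegment n) (fun z => initialSegment_glue z x)
        (fun z => initialSegment_glue z y) _ _ _) hu hv
  -- After `n ≥ 1` transfers the cost sees only the tails from `n` on, which gluing leaves
  -- unchanged; for `n = 0` the initial segments are empty.
  have hW : iteratedCost μ c n (glue u x) (glue v y) = iteratedCost μ c n x y := by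
    rcases n with _ | n
    · simp only [iteratedCost, hc]
      congr 2
    · simp only [iteratedCost, transfer]
      rw [condExpKernel_tailAlgebra_congr (tailSequence_glue u x),
        condExpKernel_tailAlgebra_congr (tailSequence_glue v y)]
  rw [← hW, markovDistance, hdp]

theorem IsMarkovChain.lintegral_markovDistance_eq (hM : IsMarkovChain μ)
    (hF : HasFiniteTransitions μ) (n : ℕ) (d : (Fin n → E) → (Fin n → E) → ℝ) :
    ∫⁻ x, ∫⁻ y, markovDistance μ n d (x n) (y n) ∂μ ∂μ =
      ∫⁻ x, ∫⁻ y, iteratedCost μ (fun x y =>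
        ENNReal.ofReal (d (initialSegment E n x) (initialSegment E n y))) n x y ∂μ ∂μ := by
  obtain ⟨G, hG, h⟩ := hM.iteratedCost_eq_markovDistance hF n d
  refine lintegral_congr_ae ?_
  filter_upwards [hG] with x hx
  refine lintegral_congr_ae ?_
  filter_upwards [hG] with y hy
  exact (h x hx y hy).symm

omit [Nonempty E] in
/-- If `c n` and `c' n` differ by sums `φ x + φ y` with small integral, then the iterated
transfers of `c' n` vanish in the limit if those of `c n` do. -/
theorem tendsto_iteratedCost_of_eventually {c c' : ℕ → (ℕ → E) → (ℕ → E) → ℝ≥0∞}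
    (h : ∀ ε : ℝ≥0∞, ε ≠ 0 → ∀ᶠ n in atTop, ∃ φ : (ℕ → E) → ℝ≥0∞, Measurable φ ∧
      ∫⁻ x, φ x ∂μ ≤ ε ∧ ∀ x y, c' n x y ≤ c n x y + (φ x + φ y))
    (hlim : Tendsto (fun n => ∫⁻ x, ∫⁻ y, iteratedCost μ (c n) n x y ∂μ ∂μ) atTop (𝓝 0)) :
    Tendsto (fun n => ∫⁻ x, ∫⁻ y, iteratedCost μ (c' n) n x y ∂μ ∂μ) atTop (𝓝 0) := by
  rw [ENNReal.tendsto_nhds_zero]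
  intro ε hε
  have hε2 : ε / 2 ≠ 0 := (ENNReal.half_pos hε.ne').ne'
  filter_upwards [h (ε / 2 / 2) (ENNReal.half_pos hε2).ne',
    hlim.eventually (ge_mem_nhds hε2.bot_lt)] with n ⟨φ, hφ, hint, hle⟩ hn
  refine (lintegral_iteratedCost_le (μ := μ) one_ne_zero ENNReal.one_ne_top hφ
    (fun x y => by rw [one_mul]; exact hle x y) n).trans ?_
  calc _ ≤ 1 * (ε / 2) + 2 * (ε / 2 / 2) := by gcongr
    _ = ε := by
      rw [one_mul, ENNReal.mul_div_cancel (by norm_num) (by norm_num), ENNReal.add_halves]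

end Criterion

end VershikStandard

end

theorem mainTheorem5 {E : Type*} [MeasurableSpace E] [StandardBorelSpace E] [Nonempty E]
    (μ : MeasureTheory.Measure (ℕ → E)) [MeasureTheory.IsProbabilityMeasure μ]
    (hM : VershikStandard.IsMarkovChain μ) (hF : VershikStandard.HasFiniteTransitions μ)
    (ρ : (ℕ → E) → (ℕ → E) → ℝ) (hρ : VershikStandard.IsAdmissibleMetric μ ρ)
    (d : (n : ℕ) → (Fin n → E) → (Fin n → E) → ℝ)
    (hd : VershikStandard.IsCylinderApproximation μ ρ d) :
    VershikStandard.IsStandardChain μ ↔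
      Tendsto (fun n => ∫⁻ x, ∫⁻ y, VershikStandard.markovDistance μ n (d n) (x n) (y n) ∂μ ∂μ)
        atTop (𝓝 0) := by
  open VershikStandard in
  have hcomp := fun (ε : ℝ≥0∞) (hε : ε ≠ 0) => hρ.eventually_comparison
    (d := fun n x y => d n (initialSegment E n x) (initialSegment E n y))
    (fun n => ⟨fun x => (hd.isSemimetric n).self_eq_zero _,
      fun x y => (hd.isSemimetric n).symm _ _, fun x y z => (hd.isSemimetric n).triangle _ _ _⟩)
    (fun n => (hd.measurable n).comp
      ((measurable_initialSegment n).prodMap (measurable_initialSegment n))) hd.tendsto hε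
  simp_rw [hM.lintegral_markovDistance_eq hF]
  constructor
  -- Ergodicity is discarded. The metric `ρ'` witnessing standardness is first exchanged for `ρ`,
  -- then `ρ` for `dₙ`.
  · rintro ⟨-, ρ', hρ', hlim⟩
    simp only [VershikStandard.iteratedSemimetric_eq] at hlim
    refine VershikStandard.tendsto_iteratedCost_of_eventually (fun ε hε => ?_)
      ((hρ'.isDominated hρ).tendsto_iteratedCost hlim)
    filter_upwards [hcomp ε hε] with n ⟨φ, h1, h2, h3⟩
    exact ⟨φ, h1, h2, fun x y => (h3 x y).1⟩
  -- Here the given `ρ` itself witnesses standardness, and ergodicity follows from the convergence.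
  · intro hlim
    have hlim' : Tendsto (fun n => ∫⁻ x, ∫⁻ y,
        VershikStandard.iteratedSemimetric μ ρ n x y ∂μ ∂μ) atTop (𝓝 0) := by
      simp only [VershikStandard.iteratedSemimetric_eq]
      refine VershikStandard.tendsto_iteratedCost_of_eventually (fun ε hε => ?_) hlim
      filter_upwards [hcomp ε hε] with n ⟨φ, h1, h2, h3⟩
      exact ⟨φ, h1, h2, fun x y => (h3 x y).2⟩
    exact ⟨VershikStandard.isErgodicChain_of_tendsto hρ hlim', ρ, hρ, hlim'⟩
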